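/- Let $p$ be a prime, $s,m,\ell\ge 1$ integers, $q=p^s$, and let $0\le r\le m$. Let $\mathbb F_{q^m}\subseteq\mathbb F_{q^{m\ell}}$ and $\mathbb F_{q^m}\subseteq\mathbb F_{q^{m(\ell+1)}}$ be the finite fields with the indicated numbers of elements, and write $N$ for the norm from $\mathbb F_{q^{m\ell}}$, respectively $\mathbb F_{q^{m(\ell+1)}}$, to $\mathbb F_{q^m}$. Let $R$ be an $r$-dimensional $\mathbb F_q$-subspace of $\mathbb F_{q^m}$ (hence of dimension $sr$ over $\mathbb F_p$) and let $$R^\perp=\{x\in\mathbb F_{q^m} : \mathrm{Tr}_{q^m/p}(xy)=0 \text{ for all } y\in R\},$$ which is an $s(m-r)$-dimensional $\mathbb F_p$-subspace and an $(m-r)$-dimensional $\mathbb F_q$-subspace of $\mathbb F_{q^m}$. Let $G$ be the additive group of $\mathbb F_{q^{m\ell}}\times\mathbb F_{q^{m(\ell+1)}}$, which is isomorphic to $\mathbb Z_p^{sm(2\ell+1)}$, and put $$D^+=\Big\{(a,b) : ab\neq 0,\ \frac{N(b)}{N(a)}\notin R^\perp\Big\}\cup\big(\{0\}\times\mathbb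 F_{q^{m(\ell+1)}}^*\big)\subseteq G .$$ A subset $D$ of a finite additive group $G$ of order $v$ with $|D|=k$ and $0\notin D$ is a $(v,k,\lambda,\mu)$ partial difference set (PDS) if the differences $g-h$ with $g,h\in D$, $g\ne h$, represent each element of $D$ exactly $\lambda$ times and each non-zero element outside $D$ exactly $\mu$ times. If $D=-D$, then $\mathrm{Cay}(G,D)$ is the graph on $G$ in which $g,h$ are adjacent if and only if $g-h\in D$. Strongly regular graphs (SRGs) are understood to be neither complete nor edgeless. Put \begin{align*} v^+&=q^{m(2\ell+1)},\\ k_r^+&=\frac{(q^m-q^{m-r})(q^{m\ell}-1)(q^{m(\ell+1)}-1)}{q^m-1}+q^{m(\ell+1)}-1,\\ \mu_r^+&=\frac{(q^m-q^{m-r})(q^{m(\ell+1)}-1)(q^{m(\ell+1)}-q^{m(\ell+1)-r}+q^{m-r}-1)}{(q^m-1)^2},\\ \lambda_r^+&=\mu_r^++\frac{q^{m(\ell+2)-r}+q^{m(\ell+1)-r}-2q^{m(\ell+1)}-2q^{m-r}+2}{q^m-1}; \end{align*} these are non-negative integers. Then the following hold. 1. $D^+$ is a $(v^+,k_r^+,\lambda_r^+,\mu_r^+)$-PDS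 in $G$, and $D^+=-D^+$. 2. $\mathrm{Cay}(G,D^+)$ is a $(v^+,k_r^+,\lambda_r^+,\mu_r^+)$-SRG, and $\{0\}\times\mathbb F_{q^{m(\ell+1)}}$ is a maximum clique of it, of size $q^{m(\ell+1)}$. 3. Put $e=\frac{q^m-1}{q-1}$, let $\gamma$ be any primitive element of $\mathbb F_{q^m}$, and put $T^\perp=\{0\le i<e : \gamma^i\in R^\perp\}$ and ${T^\perp}^c=\{0,\dots,e-1\}\setminus T^\perp$. With $C_t^{(e,q^m)}=\gamma^t\langle\gamma^e\rangle$, $$D^+=\Big\{(a,b) : ab\neq 0,\ \frac{N(b)}{N(a)}\in \bigcup_{t\in {T^\perp}^c}C^{(e,q^m)}_t\Big\}\cup\big(\{0\}\times\mathbb F_{q^{m(\ell+1)}}^*\big).$$ There are primitive elements $\alpha$ of $\mathbb F_{q^{m\ell}}$ and $\beta$ of $\mathbb F_{q^{m(\ell+1)}}$ with $N(\alpha)=N(\beta)=\gamma$. For all such $\alpha,\beta$, with the cyclotomic classes $C_i^{(e,q^{m\ell})}=\alpha^i\langle\alpha^e\rangle$ and $C_i^{(e,q^{m(\ell+1)})}=\beta^i\langle\beta^e\rangle$,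 $$D^+=\bigcup_{i=0}^{e-1}\Big(C_i^{(e,q^{m\ell})}\times\bigcup_{t\in {T^\perp}^c}C_{i+t}^{(e,q^{m(\ell+1)})}\Big)\cup\big(\{0\}\times\mathbb F_{q^{m(\ell+1)}}^*\big),$$ and $D^+$ is the complement $G\setminus(D_{m-r,T^\perp}\cup\{0\})$ of $$D_{m-r,T^\perp}=\bigcup_{i=0}^{e-1}\Big(C_i^{(e,q^{m\ell})}\times\bigcup_{t\in T^\perp}C_{i+t}^{(e,q^{m(\ell+1)})}\Big)\cup\big(\mathbb F_{q^{m\ell}}^*\times\{0\}\big).$$ 4. In particular, for all $p,s,m,\ell$ and $0\le r\le m$ as above there is a $(v^+,k_r^+,\lambda_r^+,\mu_r^+)$-PDS $D$ in $\mathbb Z_p^{sm(2\ell+1)}$ with $D=-D$, and $\mathrm{Cay}(\mathbb Z_p^{sm(2\ell+1)},D)$ is a $(v^+,k_r^+,\lambda_r^+,\mu_r^+)$-SRG. -/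

import Mathlib

namespace DualDenniston

/-- `D` is a `(v, k, lam, mu)` partial difference set in the additive group `G`
(with `0 ∉ D`, as usual when Cayley graphs are considered). -/
structure IsPDS {G : Type*} [AddGroup G] (D : Set G) (v k lam mu : ℕ) : Prop where
  card_group : Nat.card G = v
  card_set : D.ncard = k
  finite_set : D.Finite
  zero_notMem : (0 : G) ∉ D
  card_of_mem : ∀ d ∈ D,
    {x : G × G | x.1 ∈ D ∧ x.2 ∈ D ∧ x.1 ≠ x.2 ∧ x.1 - x.2 = d}.ncard = lam
  card_of_notMem : ∀ d : G, d ≠ 0 → d ∉ D →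
    {x : G × G | x.1 ∈ D ∧ x.2 ∈ D ∧ x.1 ≠ x.2 ∧ x.1 - x.2 = d}.ncard = mu

/-- The Cayley graph `Cay(G, D)` for `D = -D` with `0 ∉ D`:
`g` and `h` are adjacent iff `g - h ∈ D`. -/
def cayleyGraph {G : Type*} [AddGroup G] (D : Set G) (h0 : (0 : G) ∉ D) (hneg : -D = D) :
    SimpleGraph G where
  Adj g h := g - h ∈ D
  symm := ⟨fun g h hgh => by
    have h1 : -(g - h) ∈ -D := by simpa using hgh
    rw [hneg, neg_sub] at h1
    exact h1⟩
  loopless := ⟨fun g hg => h0 (by simpa using hg)⟩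

open Classical in
/-- A strongly regular graph, complete and edgeless graphs being excluded. -/
def IsSRG {V : Type*} [Fintype V] (Γ : SimpleGraph V) (v k lam mu : ℕ) : Prop :=
  Γ.IsSRGWith v k lam mu ∧ Γ ≠ ⊥ ∧ Γ ≠ ⊤

/-- The complement of a partial difference set (again not containing `0`). -/
def pdsComplement {G : Type*} [AddGroup G] (D : Set G) : Set G := (D ∪ {0})ᶜ

/-- A primitive element of a finite field `K`: a generator of the cyclic group `Kˣ`. -/
def IsPrimitiveElement {K : Type*} [Field K] (α : Kˣ) : Prop :=
  Subgroup.zpowers α = ⊤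

/-- The cyclotomic class `C_i = α ^ i ⟨α ^ e⟩` of order `e`. -/
def cyclotomicClass {K : Type*} [Field K] (α : Kˣ) (e i : ℕ) : Set K :=
  {x | ∃ u ∈ Subgroup.zpowers (α ^ e), x = ((α ^ i * u : Kˣ) : K)}

/-- The dual of an additive subgroup `R` of `F` with respect to the absolute trace
`F → ZMod p`. -/
def traceDual (p : ℕ) {F : Type*} [Field F] [Algebra (ZMod p) F] (R : AddSubgroup F) :
    Submodule (ZMod p) F where
  carrier := {x | ∀ y ∈ R, Algebra.trace (ZMod p) F (x * y) = 0}
  zero_mem' := fun y _ => by simp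
  add_mem' := fun ha hb y hy => by rw [add_mul, map_add, ha y hy, hb y hy, add_zero]
  smul_mem' := fun c x hx y hy => by rw [smul_mul_assoc, map_smul, hx y hy, smul_zero]

/-- The exponents `0 ≤ i < e` with `γ ^ i ∈ W`. -/
def exponentSet {F : Type*} [Field F] (γ : Fˣ) (e : ℕ) (W : Set F) : Set ℕ :=
  {i | i < e ∧ ((γ ^ i : Fˣ) : F) ∈ W}

/-- `⋃_{0 ≤ i < e} (C_i × ⋃_{t ∈ T} C_{i+t})`, the cyclotomic classes of order `e` being taken
with respect to `α` in the first and to `β` in the second factor. -/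
def cyclotomicUnion {K L : Type*} [Field K] [Field L] (α : Kˣ) (β : Lˣ) (e : ℕ) (T : Set ℕ) :
    Set (K × L) :=
  ⋃ i ∈ Set.Iio e, cyclotomicClass α e i ×ˢ ⋃ t ∈ T, cyclotomicClass β e (i + t)

/-- The set `⋃_{0 ≤ i < e} (C_i × ⋃_{t ∈ T} C_{i+t}) ∪ (K^* × {0})`. -/
def dennistonSet {K L : Type*} [Field K] [Field L] (α : Kˣ) (β : Lˣ) (e : ℕ) (T : Set ℕ) :
    Set (K × L) :=
  cyclotomicUnion α β e T ∪ ({0}ᶜ ×ˢ {0})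

/-- The set `{(a, b) : a b ≠ 0, N(b) / N(a) ∉ W} ∪ ({0} × L^*)`, with norms from `K` and `L`
down to `F`. -/
def dualDennistonSet {F : Type*} (K L : Type*) [Field F] [Field K] [Field L]
    [Algebra F K] [Algebra F L] (W : Set F) : Set (K × L) :=
  {x | x.1 ≠ 0 ∧ x.2 ≠ 0 ∧ Algebra.norm F x.2 / Algebra.norm F x.1 ∉ W} ∪ ({0} ×ˢ {0}ᶜ)

/-- The dual generalized Denniston parameter `k_r^+`. -/
def dualK (q m l r : ℕ) : ℚ :=
  ((q : ℚ) ^ m - q ^ (m - r)) * (q ^ (m * l) - 1) * (q ^ (m * (l + 1)) - 1) / (q ^ m - 1)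
    + q ^ (m * (l + 1)) - 1

/-- The dual generalized Denniston parameter `μ_r^+`. -/
def dualMu (q m l r : ℕ) : ℚ :=
  ((q : ℚ) ^ m - q ^ (m - r)) * (q ^ (m * (l + 1)) - 1)
    * (q ^ (m * (l + 1)) - q ^ (m * (l + 1) - r) + q ^ (m - r) - 1) / (q ^ m - 1) ^ 2

/-- The dual generalized Denniston parameter `λ_r^+`. -/
def dualLam (q m l r : ℕ) : ℚ :=
  ((q : ℚ) ^ m - q ^ (m - r)) * (q ^ (m * (l + 1)) - 1)
    * (q ^ (m * (l + 1)) - q ^ (m * (l + 1) - r) + q ^ (m - r) - 1) / (q ^ m - 1) ^ 2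
    + ((q : ℚ) ^ (m * (l + 2) - r) + q ^ (m * (l + 1) - r) - 2 * q ^ (m * (l + 1))
        - 2 * q ^ (m - r) + 2) / (q ^ m - 1)

end DualDenniston

namespace DualDenniston

open Polynomial

/-! ### Multiplicative weights on monic polynomials and Newton's identity -/

section MonicWeights

variable (F : Type*) [Field F] [Finite F]

/-! Write `F`, `K`, `L` for the fields with `q^m`, `q^(ml)`, `q^(m(l+1))` elements, `W` for the dual
of `R`, and `n = (|K| - 1)/(|F| - 1)` for the size of a nonzero norm fibre of `K`. The proof shows
that `D` has only two nontrivial eigenvalues, that is, character sums over `D`; a symmetric set with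
this property is a partial difference set.

The complement of `D` consists of the origin and of the pairs with `a ≠ 0` and `N(b) = w N(a)` for
some `w` in `W`. So everything reduces to the sum of `ψ(Tr(ua) + Tr(vb))` over the pairs with `a ≠
0`, `N(b) = z N(a)`. The crucial point is that `[L:F] = [K:F] + 1`. The Davenport-Hasse relation for
consecutive degrees (`sum_norm_eq_of_finrank_succ`) trades the sum over `b` in `L` of given norm for
one over `K × F`; the sum over `a` then collapses by orthogonality, and for `u, z ≠ 0` the value is
`-|K| ψ(cz) - n`, where `c = N(v)/N(-u)` (`normPairSum_of_left_ne_zero`). Since `z ↦ ψ(cz)` is a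
character of the additive group `W`, its sum over `W` is `0` or `|W|`, which gives the two
eigenvalues (`dualDennistonSet_eigenvalues`). Fourier inversion of the quadratic equation they
satisfy counts differences (`ncard_differences_of_eigenvalues`).

Davenport-Hasse is proved in the group ring of `F`: a monic polynomial is weighted by its norm, as a
group element, and its trace, through `ψ`. This weight is multiplicative and sums to zero in each
degree at least two, so its L-function is linear, and the logarithmic derivative
(`primePowerSum_eq_neg`) gives the recursion between consecutive extension degrees.

Only the order of `W` matters for the parameters. Its `E`-linearity enters in the cyclotomic
description: with `e = (q^m - 1)/(q - 1)` the group generated by `γ^e` lies in the image of `E`, so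
`W` minus zero is a union of cyclotomic classes, and norms send `α^i` and `β^i` to `γ^i`. -/

theorem finite_natDegree_le (n : ℕ) : {f : F[X] | f.natDegree ≤ n}.Finite := by
  have hfin : Finite (degreeLT F (n + 1)) := Module.finite_of_finite F
  refine Set.Finite.subset (Set.toFinite (degreeLT F (n + 1) : Set F[X])) fun f hf => ?_
  simp only [SetLike.mem_coe, mem_degreeLT]
  exact lt_of_le_of_lt degree_le_natDegree (by exact_mod_cast Nat.lt_succ_of_le hf)

/-- The monic polynomials of degree `n` over a finite field. -/
noncomputable def monics (n : ℕ) : Finset F[X] :=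
  ((finite_natDegree_le F n).subset
    (show {f : F[X] | f.Monic ∧ f.natDegree = n} ⊆ _ from fun _ hf => hf.2.le)).toFinset

/-- The monic irreducible polynomials of degree at most `n` over a finite field. -/
noncomputable def monicPrimes (n : ℕ) : Finset F[X] :=
  ((finite_natDegree_le F n).subset
    (show {f : F[X] | f.Monic ∧ Irreducible f ∧ f.natDegree ≤ n} ⊆ _ from
      fun _ hf => hf.2.2)).toFinset

variable {F}

theorem mem_monics {n : ℕ} {f : F[X]} : f ∈ monics F n ↔ f.Monic ∧ f.natDegree = n := by
  simp [monics]

theorem mem_monicPrimes {n : ℕ} {f : F[X]} :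
    f ∈ monicPrimes F n ↔ f.Monic ∧ Irreducible f ∧ f.natDegree ≤ n := by
  simp [monicPrimes]

open UniqueFactorizationMonoid Classical in
/-- The degree of a monic polynomial counts, with weight `deg P`, the prime powers `P ^ j`
dividing it. -/
theorem natDegree_eq_sum_prime_powers {f : F[X]} (hf : f.Monic) :
    f.natDegree = ∑ P ∈ monicPrimes F f.natDegree, ∑ j ∈ Finset.Icc 1 f.natDegree,
      if P ^ j ∣ f then P.natDegree else 0 := by
  have hprod : (normalizedFactors f).prod = f := by
    rw [prod_normalizedFactors_eq hf.ne_zero, hf.normalize_eq_self]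
  have hmonic : ∀ P ∈ normalizedFactors f, P.Monic := fun P hP => by
    have h := monic_normalize (irreducible_of_normalized_factor P hP).ne_zero
    rwa [normalize_normalized_factor P hP] at h
  have hle : ∀ P : F[X], P ∣ f → P.natDegree ≤ f.natDegree := fun P hP =>
    natDegree_le_of_dvd hP hf.ne_zero
  have hcount : ∀ P ∈ monicPrimes F f.natDegree,
      (∑ j ∈ Finset.Icc 1 f.natDegree, if P ^ j ∣ f then P.natDegree else 0) =
        (normalizedFactors f).count P * P.natDegree := by
    intro P hP
    obtain ⟨hPm, hPi, -⟩ := mem_monicPrimes.1 hP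
    -- The multiplicity of `P` is the number of `j ≥ 1` with `P ^ j ∣ f`, and it is at most `deg f`,
    -- so the range of `j` cuts nothing off.
    have hdvd : ∀ j : ℕ, P ^ j ∣ f ↔ j ≤ (normalizedFactors f).count P := fun j => by
      rw [pow_dvd_iff_le_emultiplicity, emultiplicity_eq_count_normalizedFactors hPi hf.ne_zero,
        hPm.normalize_eq_self]
      exact Nat.cast_le
    have hbound : (normalizedFactors f).count P ≤ f.natDegree := by
      have h1 := hle _ ((hdvd _).2 le_rfl)
      rw [natDegree_pow] at h1
      exact le_trans (Nat.le_mul_of_pos_right _ hPi.natDegree_pos) h1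
    rw [← Finset.sum_filter, Finset.sum_const, smul_eq_mul]
    congr 1
    have : (Finset.Icc 1 f.natDegree).filter (fun j => P ^ j ∣ f) =
        Finset.Icc 1 ((normalizedFactors f).count P) := by
      ext j
      simp only [Finset.mem_filter, Finset.mem_Icc, hdvd]
      omega
    rw [this, Nat.card_Icc, Nat.add_sub_cancel]
  rw [Finset.sum_congr rfl hcount]
  calc f.natDegree = (normalizedFactors f).prod.natDegree := by rw [hprod]
    _ = ∑ P ∈ (normalizedFactors f).toFinset,
          (normalizedFactors f).count P * P.natDegree := by
        rw [natDegree_multiset_prod_of_monic _ hmonic, Finset.sum_multiset_map_count]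
        simp only [smul_eq_mul]
    _ = _ := by
        refine Finset.sum_subset (fun P hP => ?_) fun P _ hP => ?_
        · rw [Multiset.mem_toFinset] at hP
          exact mem_monicPrimes.2 ⟨hmonic P hP, irreducible_of_normalized_factor P hP,
            hle P (dvd_of_mem_normalizedFactors hP)⟩
        · rw [Multiset.mem_toFinset] at hP
          rw [Multiset.count_eq_zero_of_notMem hP, zero_mul]

variable {A : Type*} [CommRing A]

/-- Multiplicativity of a weight on monic polynomials. -/
def IsMonicMultiplicative (wt : F[X] → A) : Prop :=
  wt 1 = 1 ∧ ∀ f g : F[X], f.Monic → g.Monic → wt (f * g) = wt f * wt g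

omit [Finite F] in
theorem IsMonicMultiplicative.map_pow {wt : F[X] → A} (h : IsMonicMultiplicative wt) {f : F[X]}
    (hf : f.Monic) (j : ℕ) : wt (f ^ j) = wt f ^ j := by
  induction j with
  | zero => simpa using h.1
  | succ j ih => rw [pow_succ, h.2 _ _ (hf.pow j) hf, ih, pow_succ]

open Classical in
-- Multiplication by `g` is a bijection from the monic polynomials of degree `n - deg g` onto the
-- multiples of `g` of degree `n`.
theorem sum_monics_filter_dvd {wt : F[X] → A} (h : IsMonicMultiplicative wt)
    {g : F[X]} (hg : g.Monic) (n : ℕ) :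
    ∑ f ∈ monics F n with g ∣ f, wt f =
      if g.natDegree ≤ n then wt g * ∑ f ∈ monics F (n - g.natDegree), wt f else 0 := by
  split_ifs with hn
  · rw [Finset.mul_sum]
    symm
    refine Finset.sum_bij (fun f _ => g * f) ?_ ?_ ?_ ?_
    · intro f hf
      obtain ⟨hfm, hfd⟩ := mem_monics.1 hf
      refine Finset.mem_filter.2 ⟨mem_monics.2 ⟨hg.mul hfm, ?_⟩, dvd_mul_right _ _⟩
      rw [hg.natDegree_mul hfm, hfd]
      omega
    · intro f _ f' _ hff
      exact mul_left_cancel₀ hg.ne_zero hff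
    · intro f hf
      obtain ⟨hf, k, rfl⟩ := Finset.mem_filter.1 hf
      obtain ⟨hfm, hfd⟩ := mem_monics.1 hf
      have hk : k.Monic := hg.of_mul_monic_left hfm
      refine ⟨k, mem_monics.2 ⟨hk, ?_⟩, rfl⟩
      rw [hg.natDegree_mul hk] at hfd
      omega
    · intro f hf
      exact (h.2 g f hg (mem_monics.1 hf).1).symm
  · refine Finset.sum_eq_zero fun f hf => absurd ?_ hn
    obtain ⟨hf, hd⟩ := Finset.mem_filter.1 hf
    obtain ⟨hfm, hfd⟩ := mem_monics.1 hf
    exact hfd ▸ natDegree_le_of_dvd hd hfm.ne_zero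

/-- The sum of `deg P * wt (P) ^ j` over the prime powers `P ^ j` of degree `k`, where `j` and
`deg P` are at most `n`. -/
noncomputable def primePowerSum (wt : F[X] → A) (n k : ℕ) : A :=
  ∑ P ∈ monicPrimes F n, ∑ j ∈ Finset.Icc 1 n,
    if j * P.natDegree = k then (P.natDegree : A) * wt P ^ j else 0

/-- The Newton identity between the sums of a multiplicative weight over monic polynomials and
over prime powers, when the former vanish in all degrees at least two. -/
theorem primePowerSum_eq_neg {wt : F[X] → A} (h : IsMonicMultiplicative wt)
    (hvanish : ∀ n, 2 ≤ n → ∑ f ∈ monics F n, wt f = 0) {n : ℕ} (hn : 2 ≤ n) :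
    primePowerSum wt n n = - (primePowerSum wt n (n - 1) * ∑ f ∈ monics F 1, wt f) := by
  classical
  have hzero : ∑ f ∈ monics F 0, wt f = 1 := by
    have : monics F 0 = {1} := by
      ext f
      simp only [mem_monics, Finset.mem_singleton]
      refine ⟨fun hf => hf.1.natDegree_eq_zero.1 hf.2, ?_⟩
      rintro rfl
      exact ⟨monic_one, natDegree_one⟩
    rw [this, Finset.sum_singleton, h.1]
  -- Newton's identity `n h_n = ∑ p_k h_(n-k)`, with `h` the sums over monics and `p` those over
  -- prime powers: the factor `n = deg f` is expanded over the prime powers dividing `f`. Only `k =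
  -- n` (where `h_0 = 1`) and `k = n - 1` survive.
  have key : ∑ f ∈ monics F n, (n : A) * wt f =
      primePowerSum wt n n + primePowerSum wt n (n - 1) * ∑ f ∈ monics F 1, wt f := by
    calc ∑ f ∈ monics F n, (n : A) * wt f
        = ∑ f ∈ monics F n, ∑ P ∈ monicPrimes F n, ∑ j ∈ Finset.Icc 1 n,
            if P ^ j ∣ f then (P.natDegree : A) * wt f else 0 := by
          refine Finset.sum_congr rfl fun f hf => ?_
          obtain ⟨hfm, hfd⟩ := mem_monics.1 hf
          have h1 := natDegree_eq_sum_prime_powers hfm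
          rw [hfd] at h1
          conv_lhs => rw [h1]
          push_cast
          simp only [Finset.sum_mul, ite_mul, zero_mul]
      _ = ∑ P ∈ monicPrimes F n, ∑ j ∈ Finset.Icc 1 n, (P.natDegree : A) *
            ∑ f ∈ monics F n with P ^ j ∣ f, wt f := by
          rw [Finset.sum_comm]
          refine Finset.sum_congr rfl fun P _ => ?_
          rw [Finset.sum_comm]
          refine Finset.sum_congr rfl fun j _ => ?_
          rw [Finset.mul_sum, Finset.sum_filter]
      _ = _ := by
          unfold primePowerSum
          rw [Finset.sum_mul, ← Finset.sum_add_distrib]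
          refine Finset.sum_congr rfl fun P hP => ?_
          rw [Finset.sum_mul, ← Finset.sum_add_distrib]
          refine Finset.sum_congr rfl fun j _ => ?_
          have hPm := (mem_monicPrimes.1 hP).1
          rw [sum_monics_filter_dvd h (hPm.pow j), natDegree_pow, h.map_pow hPm]
          rcases lt_or_ge n (j * P.natDegree) with h1 | h1
          · rw [if_neg (by omega), if_neg (by omega), if_neg (by omega)]
            simp
          rw [if_pos h1]
          by_cases h2 : j * P.natDegree = n
          · rw [if_pos h2, if_neg (by omega), h2, Nat.sub_self, hzero]
            ring
          by_cases h3 : j * P.natDegree = n - 1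
          · rw [if_neg h2, if_pos h3, h3, show n - (n - 1) = 1 by omega]
            ring
          rw [if_neg h2, if_neg h3, hvanish _ (by omega)]
          ring
  rw [← Finset.mul_sum, hvanish n hn, mul_zero] at key
  exact eq_neg_of_add_eq_zero_left key.symm

end MonicWeights

/-! ### From prime powers to elements of an extension field -/

section FieldSum

variable {F : Type*} [Field F] [Fintype F] {K : Type*} [Field K] [Fintype K] [Algebra F K]

/-- As `deg P` divides `[K:F]`, `P` divides `X ^ |K| - X`, hence splits in `K` with distinct roots;
these roots are the elements with minimal polynomial `P`. -/
theorem card_filter_minpoly_eq [DecidableEq F[X]] {P : F[X]} (hPm : P.Monic) (hPi : Irreducible P)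
    (hd : P.natDegree ∣ Module.finrank F K) :
    (Finset.univ.filter fun a : K => minpoly F a = P).card = P.natDegree := by
  classical
  have hn : Module.finrank F K ≠ 0 := Module.finrank_pos.ne'
  have hcard : Fintype.card K = Nat.card F ^ Module.finrank F K := by
    rw [Nat.card_eq_fintype_card]; exact Module.card_eq_pow_finrank
  have hdvd : P ∣ X ^ Fintype.card K - X := by
    rw [hcard]
    exact (hPi.natDegree_dvd_iff_dvd_X_pow_card_pow_sub_X).1 hd
  have hne : (X ^ Fintype.card K - X : K[X]) ≠ 0 :=
    FiniteField.X_pow_card_sub_X_ne_zero K Fintype.one_lt_card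
  have hsp : (P.map (algebraMap F K)).Splits := by
    refine (FiniteField.isSplittingField_sub K F).splits'.of_dvd ?_ ?_
    · simpa using hne
    · exact Polynomial.map_dvd _ hdvd
  have hsep : P.Separable := PerfectField.separable_of_irreducible hPi
  rw [← card_rootSet_eq_natDegree hsep hsp, ← Set.toFinset_card]
  congr 1
  ext a
  simp only [Finset.mem_filter, Finset.mem_univ, true_and, Set.mem_toFinset,
    mem_rootSet_of_ne hPm.ne_zero]
  constructor
  · rintro rfl
    exact minpoly.aeval F a
  · intro ha
    exact (minpoly.eq_of_irreducible_of_monic hPi ha hPm).symm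

omit [Fintype F] in
theorem finrank_adjoin_eq_div (a : K) :
    Module.finrank F K / (minpoly F a).natDegree =
      Module.finrank (IntermediateField.adjoin F {a}) K := by
  have h1 := Module.finrank_mul_finrank F (IntermediateField.adjoin F {a}) K
  rw [IntermediateField.adjoin.finrank (Algebra.IsIntegral.isIntegral a)] at h1
  rw [← h1, Nat.mul_div_cancel_left _ (minpoly.natDegree_pos (Algebra.IsIntegral.isIntegral a))]

omit [Fintype F] in
theorem natDegree_minpoly_dvd (a : K) : (minpoly F a).natDegree ∣ Module.finrank F K := by
  have h1 := Module.finrank_mul_finrank F (IntermediateField.adjoin F {a}) K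
  rw [IntermediateField.adjoin.finrank (Algebra.IsIntegral.isIntegral a)] at h1
  exact ⟨_, h1.symm⟩

/-- Group the elements by minimal polynomial. A prime `P` contributes only if `deg P` divides
`[K:F]`, and then only through the power `j = [K:F] / deg P`. The bound `n` is left free so that
sums for two different fields share one index range. -/
theorem sum_minpoly_eq_primePowerSum {A : Type*} [CommRing A] (wt : F[X] → A) {n : ℕ}
    (hn : Module.finrank F K ≤ n) :
    ∑ a : K, wt (minpoly F a) ^ (Module.finrank F K / (minpoly F a).natDegree) =
      primePowerSum wt n (Module.finrank F K) := by
  classical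
  have hpos : 0 < Module.finrank F K := Module.finrank_pos
  have hmaps : ∀ a ∈ (Finset.univ : Finset K), minpoly F a ∈ monicPrimes F n := fun a _ =>
    mem_monicPrimes.2 ⟨minpoly.monic (Algebra.IsIntegral.isIntegral a),
      minpoly.irreducible (Algebra.IsIntegral.isIntegral a),
      le_trans (Nat.le_of_dvd hpos (natDegree_minpoly_dvd a)) hn⟩
  rw [← Finset.sum_fiberwise_of_maps_to hmaps, primePowerSum]
  refine Finset.sum_congr rfl fun P hP => ?_
  obtain ⟨hPm, hPi, -⟩ := mem_monicPrimes.1 hP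
  have hPpos := hPi.natDegree_pos
  have h1 : ∑ a : K with minpoly F a = P,
      wt (minpoly F a) ^ (Module.finrank F K / (minpoly F a).natDegree) =
      ∑ a : K with minpoly F a = P, wt P ^ (Module.finrank F K / P.natDegree) :=
    Finset.sum_congr rfl fun a ha => by rw [(Finset.mem_filter.1 ha).2]
  rw [h1, Finset.sum_const, nsmul_eq_mul]
  by_cases hd : P.natDegree ∣ Module.finrank F K
  · rw [card_filter_minpoly_eq hPm hPi hd]
    obtain ⟨j, hj⟩ := hd
    have hj0 : j ≠ 0 := by rintro rfl; omega
    have hjn : j ≤ n := le_trans (Nat.le_mul_of_pos_left j hPpos) (hj ▸ hn)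
    rw [Finset.sum_eq_single_of_mem j (Finset.mem_Icc.2 ⟨by omega, hjn⟩), hj,
      Nat.mul_div_cancel_left _ hPpos, if_pos (mul_comm _ _)]
    intro i _ hij
    rw [if_neg]
    intro hi
    rw [hj, mul_comm] at hi
    exact hij (Nat.eq_of_mul_eq_mul_left hPpos hi)
  · have hempty : (Finset.univ.filter fun a : K => minpoly F a = P) = ∅ := by
      refine Finset.filter_eq_empty_iff.2 fun a _ ha => hd ?_
      rw [← ha]
      exact natDegree_minpoly_dvd a
    rw [hempty]
    simp only [Finset.card_empty, Nat.cast_zero, zero_mul]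
    symm
    refine Finset.sum_eq_zero fun j _ => if_neg fun hj => hd ⟨j, ?_⟩
    rw [← hj, mul_comm]

end FieldSum

/-! ### The norm-trace weight and the Davenport-Hasse relation -/

section NormTraceWeight

variable {F : Type*} [Field F] (ψ : AddChar F ℂ)

/-- The weight of a monic polynomial recording its norm and, through `ψ`, its trace. -/
noncomputable def normTraceWeight (f : F[X]) : MonoidAlgebra ℂ F :=
  MonoidAlgebra.single ((-1) ^ f.natDegree * f.coeff 0) (ψ (-f.nextCoeff))

theorem isMonicMultiplicative_normTraceWeight : IsMonicMultiplicative (normTraceWeight ψ) := by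
  constructor
  · have h1 : (1 : F[X]).nextCoeff = 0 := by simp [nextCoeff]
    simp [normTraceWeight, h1, MonoidAlgebra.one_def]
  · intro f g hf hg
    simp only [normTraceWeight]
    rw [MonoidAlgebra.single_mul_single, hf.natDegree_mul hg, mul_coeff_zero,
      hf.nextCoeff_mul hg, neg_add, AddChar.map_add_eq_mul]
    congr 1
    ring

section

variable [Fintype F]

/-- Shifting the coefficient of `X ^ (n - 1)` permutes the monics of degree `n` and scales the
weight by a value `ψ c ≠ 1`. For `n ≥ 2` this coefficient is not the constant one, so the norm part
is unaffected. -/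
theorem sum_monics_normTraceWeight_eq_zero (hψ : ψ ≠ 1) {n : ℕ} (hn : 2 ≤ n) :
    ∑ f ∈ monics F n, normTraceWeight ψ f = 0 := by
  classical
  obtain ⟨c, hc⟩ : ∃ c, ψ c ≠ 1 := by
    by_contra! hcon
    exact hψ (by ext x; simpa using hcon x)
  have hdeg : ∀ (b : F) {f : F[X]}, f ∈ monics F n → f + C b * X ^ (n - 1) ∈ monics F n := by
    intro b f hf
    obtain ⟨hfm, hfd⟩ := mem_monics.1 hf
    have hlt : (C b * X ^ (n - 1) : F[X]).degree < f.degree := by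
      refine lt_of_le_of_lt (degree_C_mul_X_pow_le _ _) ?_
      rw [degree_eq_natDegree hfm.ne_zero, hfd]
      exact_mod_cast (by omega : n - 1 < n)
    refine mem_monics.2 ⟨hfm.add_of_left hlt, ?_⟩
    rw [natDegree_add_eq_left_of_degree_lt hlt, hfd]
  have hshift : ∑ f ∈ monics F n, normTraceWeight ψ f =
      ψ c • ∑ f ∈ monics F n, normTraceWeight ψ f := by
    rw [Finset.smul_sum]
    refine (Finset.sum_bij (fun f _ => f + C (-c) * X ^ (n - 1)) (fun f hf => hdeg _ hf)
      (fun f _ g _ hfg => add_right_cancel hfg) (fun f hf => ⟨f + C c * X ^ (n - 1),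
        hdeg _ hf, by simp⟩) fun f hf => ?_).symm
    have hd := (mem_monics.1 hf).2
    have hd' := (mem_monics.1 (hdeg (-c) hf)).2
    simp only [normTraceWeight, hd, hd']
    rw [nextCoeff_of_natDegree_pos (by omega), nextCoeff_of_natDegree_pos (by omega), hd, hd']
    simp only [coeff_add, coeff_C_mul, coeff_X_pow, if_true, mul_one,
      if_neg (show (0 : ℕ) ≠ n - 1 by omega), mul_zero, add_zero, neg_add, neg_neg]
    rw [MonoidAlgebra.smul_single, AddChar.map_add_eq_mul, smul_eq_mul, mul_comm (ψ c)]
  have h0 : (1 - ψ c) • ∑ f ∈ monics F n, normTraceWeight ψ f = 0 := by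
    rw [sub_smul, one_smul, ← hshift, sub_self]
  exact (smul_eq_zero.1 h0).resolve_left (sub_ne_zero.2 (Ne.symm hc))

theorem sum_monics_one_normTraceWeight :
    ∑ f ∈ monics F 1, normTraceWeight ψ f = ∑ c : F, MonoidAlgebra.single c (ψ c) := by
  symm
  refine Finset.sum_bij (fun c _ => X - C c)
    (fun c _ => mem_monics.2 ⟨monic_X_sub_C c, natDegree_X_sub_C c⟩)
    (fun c _ d _ h => C_injective (sub_right_injective h)) (fun f hf => ?_) fun c _ => ?_
  · obtain ⟨hfm, hfd⟩ := mem_monics.1 hf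
    refine ⟨-f.coeff 0, Finset.mem_univ _, ?_⟩
    rw [C_neg, sub_neg_eq_add]
    exact (hfm.eq_X_add_C hfd).symm
  · simp [normTraceWeight, nextCoeff_X_sub_C]

end

variable {K : Type*} [Field K] [Fintype K] [Algebra F K]

/-- The exponent is `[K:F(a)]`: the norm of `a` from `K` is that power of its norm from `F(a)`, and
the trace is that multiple. -/
theorem normTraceWeight_minpoly_pow (a : K) :
    normTraceWeight ψ (minpoly F a) ^ (Module.finrank F K / (minpoly F a).natDegree) =
      MonoidAlgebra.single (Algebra.norm F a) (ψ (Algebra.trace F K a)) := by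
  have hint : IsIntegral F a := Algebra.IsIntegral.isIntegral a
  rw [normTraceWeight, MonoidAlgebra.single_pow, finrank_adjoin_eq_div,
    trace_eq_finrank_mul_minpoly_nextCoeff, Algebra.norm_eq_norm_adjoin,
    ← IntermediateField.adjoin.powerBasis_gen hint,
    Algebra.PowerBasis.norm_gen_eq_coeff_zero_minpoly, IntermediateField.adjoin.powerBasis_gen,
    IntermediateField.minpoly_gen, IntermediateField.adjoin.powerBasis_dim, ← nsmul_eq_mul,
    AddChar.map_nsmul_eq_pow]

variable [Fintype F]

/-- The Davenport-Hasse relation for fields of consecutive degrees over `F`, as an identity in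
the group ring of `F`. -/
theorem davenport_hasse_step (hψ : ψ ≠ 1) {L : Type*} [Field L] [Fintype L] [Algebra F L]
    (hKL : Module.finrank F L = Module.finrank F K + 1) :
    ∑ b : L, MonoidAlgebra.single (Algebra.norm F b) (ψ (Algebra.trace F L b)) =
      -((∑ a : K, MonoidAlgebra.single (Algebra.norm F a) (ψ (Algebra.trace F K a))) *
        ∑ c : F, MonoidAlgebra.single c (ψ c)) := by
  have hpos : 0 < Module.finrank F K := Module.finrank_pos
  have h := primePowerSum_eq_neg (isMonicMultiplicative_normTraceWeight ψ)
    (fun n hn => sum_monics_normTraceWeight_eq_zero ψ hψ hn)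
    (show 2 ≤ Module.finrank F L by omega)
  rw [show Module.finrank F L - 1 = Module.finrank F K by omega,
    ← sum_minpoly_eq_primePowerSum (K := L) _ le_rfl,
    ← sum_minpoly_eq_primePowerSum (K := K) _ (by omega : _ ≤ Module.finrank F L),
    sum_monics_one_normTraceWeight] at h
  simpa only [normTraceWeight_minpoly_pow] using h

/-- The Davenport-Hasse relation for fields of consecutive degrees over `F`, coefficientwise. -/
theorem sum_norm_eq_of_finrank_succ [DecidableEq F] (hψ : ψ ≠ 1) {L : Type*} [Field L] [Fintype L]
    [Algebra F L] (hKL : Module.finrank F L = Module.finrank F K + 1) (z : F) :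
    (∑ b : L, if Algebra.norm F b = z then ψ (Algebra.trace F L b) else 0) =
      -∑ a : K, ∑ c : F,
        if Algebra.norm F a * c = z then ψ (Algebra.trace F K a) * ψ c else 0 := by
  have h := congrArg (fun x : MonoidAlgebra ℂ F => x.coeff z)
    (davenport_hasse_step ψ (K := K) hψ hKL)
  simp only [Finset.sum_mul_sum, MonoidAlgebra.single_mul_single] at h
  simpa [Finsupp.single_apply, Finsupp.finsetSum_apply, ← ite_and] using h

end NormTraceWeight

/-! ### Partial difference sets: Cayley graphs, transport, eigenvalue criterion -/

section PartialDifferenceSets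

theorem ncard_commonNeighbors_cayleyGraph {G : Type*} [AddGroup G] {D : Set G}
    (h0 : (0 : G) ∉ D) (hneg : -D = D) (g h : G) (hgh : g ≠ h) :
    ((cayleyGraph D h0 hneg).commonNeighbors g h).ncard =
      {x : G × G | x.1 ∈ D ∧ x.2 ∈ D ∧ x.1 ≠ x.2 ∧ x.1 - x.2 = g - h}.ncard := by
  refine Set.ncard_congr (fun z _ => (g - z, h - z)) ?_ ?_ ?_
  · rintro z ⟨hz1, hz2⟩
    refine ⟨hz1, hz2, fun he => hgh (sub_left_injective he), ?_⟩
    simp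
  · intro z z' _ _ hzz
    exact sub_right_injective (Prod.ext_iff.1 hzz).1
  · rintro ⟨x, y⟩ ⟨hx, hy, -, hxy⟩
    simp only at hx hy hxy
    -- The group need not be commutative, so the solution `z` of `g - z = x` is `-x + g`, in this
    -- order.
    have hyx : h - (-x + g) = y := by
      have : h = -(x - y) + g := by rw [hxy]; simp
      rw [this]
      simp [sub_eq_add_neg, add_assoc]
    refine ⟨-x + g, ⟨?_, ?_⟩, ?_⟩
    · change g - (-x + g) ∈ D
      simpa [sub_eq_add_neg] using hx
    · change h - (-x + g) ∈ D
      rwa [hyx]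
    · simp only [hyx]
      simp [sub_eq_add_neg]

theorem IsPDS.isSRG {G : Type*} [AddGroup G] [Fintype G] {D : Set G} {v k lam mu : ℕ}
    (hD : IsPDS D v k lam mu) (h0 : (0 : G) ∉ D) (hneg : -D = D) (hne : D.Nonempty)
    (hco : ∃ g, g ≠ 0 ∧ g ∉ D) : IsSRG (cayleyGraph D h0 hneg) v k lam mu := by
  classical
  refine ⟨⟨?_, ?_, ?_, ?_⟩, ?_, ?_⟩
  · rw [← hD.card_group, Nat.card_eq_fintype_card]
  · intro g
    rw [← SimpleGraph.card_neighborSet_eq_degree, ← Nat.card_eq_fintype_card, ← hD.card_set]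
    refine Set.ncard_congr (s := (cayleyGraph D h0 hneg).neighborSet g) (fun z _ => g - z) ?_ ?_ ?_
    · exact fun z hz => hz
    · exact fun z z' _ _ hzz => sub_right_injective hzz
    · intro x hx
      have : g - (-x + g) = x := by simp [sub_eq_add_neg]
      refine ⟨-x + g, ?_, this⟩
      change g - (-x + g) ∈ D
      rwa [this]
  · intro g h hgh
    rw [← Nat.card_eq_fintype_card]
    exact (ncard_commonNeighbors_cayleyGraph h0 hneg g h hgh.ne).trans (hD.card_of_mem _ hgh)
  · intro g h hne hgh
    rw [← Nat.card_eq_fintype_card]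
    exact (ncard_commonNeighbors_cayleyGraph h0 hneg g h hne).trans
      (hD.card_of_notMem _ (sub_ne_zero.2 hne) hgh)
  · intro hbot
    obtain ⟨d, hd⟩ := hne
    have : (cayleyGraph D h0 hneg).Adj d 0 := by
      change d - 0 ∈ D
      rwa [sub_zero]
    rw [hbot] at this
    exact this
  · intro htop
    obtain ⟨g, hg, hgD⟩ := hco
    have : (cayleyGraph D h0 hneg).Adj g 0 := by
      rw [htop]
      exact hg
    refine hgD ?_
    have h1 : g - 0 ∈ D := this
    rwa [sub_zero] at h1

theorem IsPDS.map {G H : Type*} [AddGroup G] [AddGroup H] (φ : G ≃+ H) {D : Set G}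
    {v k lam mu : ℕ} (hD : IsPDS D v k lam mu) : IsPDS (φ '' D) v k lam mu := by
  have hcount : ∀ d : H,
      {x : H × H | x.1 ∈ φ '' D ∧ x.2 ∈ φ '' D ∧ x.1 ≠ x.2 ∧ x.1 - x.2 = d}.ncard =
      {x : G × G | x.1 ∈ D ∧ x.2 ∈ D ∧ x.1 ≠ x.2 ∧ x.1 - x.2 = φ.symm d}.ncard := by
    intro d
    rw [← Set.ncard_image_of_injective _ (φ.injective.prodMap φ.injective)]
    congr 1
    ext ⟨x, y⟩
    constructor
    · rintro ⟨⟨a, ha, rfl⟩, ⟨b, hb, rfl⟩, hab, hd⟩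
      refine ⟨(a, b), ⟨ha, hb, fun h => hab (by simpa using h), ?_⟩, rfl⟩
      simp only at hd
      rw [← hd]
      simp
    · rintro ⟨⟨a, b⟩, ⟨ha, hb, hab, hd⟩, he⟩
      simp only [Prod.map_apply, Prod.mk.injEq] at he hab hd
      obtain ⟨rfl, rfl⟩ := he
      refine ⟨⟨a, ha, rfl⟩, ⟨b, hb, rfl⟩, fun h => hab (φ.injective h), ?_⟩
      simp only [← map_sub, hd, AddEquiv.apply_symm_apply]
  refine ⟨?_, ?_, hD.finite_set.image φ, ?_, ?_, ?_⟩
  · rw [← hD.card_group, Nat.card_congr φ.toEquiv]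
  · rw [Set.ncard_image_of_injective _ φ.injective, hD.card_set]
  · rintro ⟨x, hx, hx0⟩
    rw [(map_eq_zero_iff φ φ.injective).1 hx0] at hx
    exact hD.zero_notMem hx
  · rintro _ ⟨d, hd, rfl⟩
    rw [hcount]
    exact hD.card_of_mem _ (by simpa using hd)
  · intro d hd hdD
    rw [hcount]
    exact hD.card_of_notMem _ (by simpa using hd) fun h => hdD ⟨_, h, by simp⟩

/-- Counting differences from two character values: if `D = -D` and every nontrivial member of a
complete orthogonal family of characters takes the value `θ₁` or `θ₂` on `D`, then the number of
representations of a nonzero element as a difference depends only on its membership in `D`. -/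
theorem ncard_differences_of_eigenvalues {G I : Type*} [AddCommGroup G] [Fintype G] [Fintype I]
    [DecidableEq G] (D : Finset G) (hneg : ∀ x ∈ D, -x ∈ D)
    (χ : I → AddChar G ℂ) (i₀ : I) (hi₀ : χ i₀ = 1)
    (horth : ∀ x, ∑ i, χ i x = if x = 0 then (Fintype.card G : ℂ) else 0) (θ₁ θ₂ : ℂ)
    (hθ : ∀ i, i ≠ i₀ → (∑ x ∈ D, χ i x = θ₁) ∨ (∑ x ∈ D, χ i x = θ₂)) (d : G) (hd : d ≠ 0) :
    (Fintype.card G : ℂ) *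
        {x : G × G | x.1 ∈ D ∧ x.2 ∈ D ∧ x.1 ≠ x.2 ∧ x.1 - x.2 = d}.ncard =
      (Fintype.card G : ℂ) * (if d ∈ D then θ₁ + θ₂ else 0) +
        ((D.card : ℂ) ^ 2 - (θ₁ + θ₂) * D.card + θ₁ * θ₂) := by
  classical
  have hcard : ({x : G × G | x.1 ∈ D ∧ x.2 ∈ D ∧ x.1 ≠ x.2 ∧ x.1 - x.2 = d}.ncard : ℂ) =
      ∑ x ∈ D, ∑ y ∈ D, if x + y - d = 0 then 1 else 0 := by
    have hset : {x : G × G | x.1 ∈ D ∧ x.2 ∈ D ∧ x.1 ≠ x.2 ∧ x.1 - x.2 = d} =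
        (((D ×ˢ D).filter fun x => x.1 - x.2 = d : Finset (G × G)) : Set (G × G)) := by
      ext x
      simp only [Set.mem_ofPred_eq, Finset.coe_filter, Finset.mem_product]
      constructor
      · rintro ⟨h1, h2, -, h3⟩
        exact ⟨⟨h1, h2⟩, h3⟩
      · rintro ⟨⟨h1, h2⟩, h3⟩
        refine ⟨h1, h2, fun h => hd ?_, h3⟩
        rw [← h3, h, sub_self]
    rw [hset, Set.ncard_coe_finset, Finset.card_filter, Finset.sum_product]
    push_cast
    refine Finset.sum_congr rfl fun x _ => ?_
    -- Since `D = -D`, differences can be counted as sums, which makes squares of character sums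
    -- appear instead of squared absolute values.
    refine Finset.sum_nbij' (fun y => -y) (fun y => -y) (fun y hy => hneg y hy)
      (fun y hy => hneg y hy) (fun y _ => neg_neg y) (fun y _ => neg_neg y) fun y _ => ?_
    simp only [← sub_eq_add_neg, sub_eq_zero (a := x - y)]
  set E : I → ℂ := fun i => ∑ x ∈ D, χ i x
  have hE0 : E i₀ = D.card := by simp [E, hi₀]
  -- Every nontrivial `E i` is a root of `(X - θ₁)(X - θ₂)`; the last term corrects the trivial
  -- character. Weighting by `χ i (-d)` and summing inverts the Fourier transform.
  have hquad : ∀ i, E i ^ 2 = (θ₁ + θ₂) * E i - θ₁ * θ₂ +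
      if i = i₀ then (D.card : ℂ) ^ 2 - (θ₁ + θ₂) * D.card + θ₁ * θ₂ else 0 := by
    intro i
    split_ifs with hi
    · rw [hi, hE0]
      ring
    · rcases hθ i hi with h | h
      · simp only [E, h]
        ring
      · simp only [E, h]
        ring
  have h1 : ∑ i, χ i (-d) * E i ^ 2 = (Fintype.card G : ℂ) *
      {x : G × G | x.1 ∈ D ∧ x.2 ∈ D ∧ x.1 ≠ x.2 ∧ x.1 - x.2 = d}.ncard := by
    rw [hcard, Finset.mul_sum]
    calc ∑ i, χ i (-d) * E i ^ 2 = ∑ i, ∑ x ∈ D, ∑ y ∈ D, χ i (x + y - d) := by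
          refine Finset.sum_congr rfl fun i _ => ?_
          rw [sq, Finset.sum_mul_sum, Finset.mul_sum]
          refine Finset.sum_congr rfl fun x _ => ?_
          rw [Finset.mul_sum]
          refine Finset.sum_congr rfl fun y _ => ?_
          rw [sub_eq_add_neg, AddChar.map_add_eq_mul, AddChar.map_add_eq_mul]
          ring
      _ = _ := by
          rw [Finset.sum_comm]
          refine Finset.sum_congr rfl fun x _ => ?_
          rw [Finset.sum_comm, Finset.mul_sum]
          refine Finset.sum_congr rfl fun y _ => ?_
          rw [horth]
          simp
  have h2 : ∑ i, χ i (-d) * E i = (Fintype.card G : ℂ) * if d ∈ D then 1 else 0 := by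
    calc ∑ i, χ i (-d) * E i = ∑ x ∈ D, ∑ i, χ i (x - d) := by
          rw [Finset.sum_comm]
          refine Finset.sum_congr rfl fun i _ => ?_
          rw [Finset.mul_sum]
          refine Finset.sum_congr rfl fun x _ => ?_
          rw [sub_eq_add_neg, AddChar.map_add_eq_mul, mul_comm]
      _ = _ := by
          simp only [horth, sub_eq_zero, Finset.sum_ite_eq', mul_ite, mul_one, mul_zero]
  have h3 : ∑ i, χ i (-d) = 0 := by
    rw [horth, if_neg (neg_ne_zero.2 hd)]
  rw [← h1]
  calc ∑ i, χ i (-d) * E i ^ 2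
      = (θ₁ + θ₂) * ∑ i, χ i (-d) * E i - θ₁ * θ₂ * ∑ i, χ i (-d) +
        ∑ i, χ i (-d) * (if i = i₀ then
          (D.card : ℂ) ^ 2 - (θ₁ + θ₂) * D.card + θ₁ * θ₂ else 0) := by
        rw [Finset.mul_sum, Finset.mul_sum, ← Finset.sum_sub_distrib, ← Finset.sum_add_distrib]
        refine Finset.sum_congr rfl fun i _ => ?_
        rw [hquad]
        ring
    _ = _ := by
        rw [h2, h3]
        simp only [mul_ite, mul_zero, Finset.sum_ite_eq', Finset.mem_univ, if_true, hi₀,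
          AddChar.one_apply, mul_one, one_mul, sub_zero]
        split_ifs <;> ring

end PartialDifferenceSets

/-! ### Sizes of norm fibres -/

section NormFibres

variable {F : Type*} [Field F] [DecidableEq F]
variable {K : Type*} [Field K] [Fintype K] [Algebra F K]

variable (F K) in
/-- The number of elements of norm `1`. -/
noncomputable def normFibreCard : ℕ := (Finset.univ.filter fun a : K => Algebra.norm F a = 1).card

theorem card_filter_norm_eq [Finite F] {z : F} (hz : z ≠ 0) :
    (Finset.univ.filter fun a : K => Algebra.norm F a = z).card = normFibreCard F K := by
  obtain ⟨c, rfl⟩ := FiniteField.norm_surjective F K z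
  have hc : c ≠ 0 := by
    rintro rfl
    exact hz (Algebra.norm_zero)
  refine (Finset.card_nbij' (fun a => c * a) (fun a => c⁻¹ * a) ?_ ?_ ?_ ?_).symm
  · intro a ha
    simp only [Finset.coe_filter, Finset.mem_univ, true_and, Set.mem_ofPred_eq] at ha ⊢
    rw [map_mul, ha, mul_one]
  · intro a ha
    simp only [Finset.coe_filter, Finset.mem_univ, true_and, Set.mem_ofPred_eq] at ha ⊢
    rw [map_mul, ha, ← map_mul, inv_mul_cancel₀ hc, map_one]
  · intro a _
    simp [hc]
  · intro a _
    simp [hc]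

variable [Fintype F]

/-- All fibres over nonzero elements have equal size; `g 0 = 0` discards the fibre over zero, which
is a single point. -/
theorem sum_comp_norm (g : F → ℂ) (hg : g 0 = 0) :
    ∑ a : K, g (Algebra.norm F a) = normFibreCard F K * ∑ z, g z := by
  rw [← Finset.sum_fiberwise (s := Finset.univ) (g := fun a : K => Algebra.norm F a),
    Finset.mul_sum]
  refine Finset.sum_congr rfl fun z _ => ?_
  rw [Finset.sum_congr rfl (g := fun _ => g z)
    fun a ha => by rw [(Finset.mem_filter.1 ha).2], Finset.sum_const, nsmul_eq_mul]
  by_cases hz : z = 0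
  · rw [hz, hg, mul_zero, mul_zero]
  · rw [card_filter_norm_eq hz]

theorem sum_ite_eq_zero {E : Type*} [Zero E] [Fintype E] [DecidableEq E] :
    ∑ x : E, (if x = 0 then (0 : ℂ) else 1) = (Fintype.card E : ℂ) - 1 := by
  have h : ∀ x : E, (if x = 0 then (0 : ℂ) else 1) = 1 - if x = 0 then 1 else 0 := fun x => by
    split_ifs <;> norm_num
  simp [h, Finset.sum_sub_distrib]

theorem normFibreCard_mul :
    (normFibreCard F K : ℂ) * ((Fintype.card F : ℂ) - 1) = (Fintype.card K : ℂ) - 1 := by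
  classical
  have h := sum_comp_norm (K := K) (fun z : F => if z = 0 then (0 : ℂ) else 1) (by simp)
  rw [sum_ite_eq_zero] at h
  rw [← h, ← sum_ite_eq_zero]
  exact Finset.sum_congr rfl fun a _ => by simp only [Algebra.norm_eq_zero_iff]

end NormFibres

/-! ### Additive characters lifted by the trace -/

section TraceCharacter

variable {F : Type*} [Field F] [Fintype F] (ψ : AddChar F ℂ)

/-- The additive character `ψ ∘ Tr` of an extension field. -/
noncomputable def traceChar (K : Type*) [Field K] [Algebra F K] : AddChar K ℂ :=
  ψ.compAddMonoidHom (Algebra.trace F K).toAddMonoidHom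

variable {K : Type*} [Field K] [Fintype K] [Algebra F K]

omit [Fintype F] [Fintype K] in
theorem traceChar_apply (a : K) : traceChar ψ K a = ψ (Algebra.trace F K a) := rfl

theorem isPrimitive_traceChar (hψ : ψ ≠ 1) : (traceChar ψ K).IsPrimitive := by
  refine AddChar.IsPrimitive.of_ne_one fun h => hψ ?_
  ext x
  obtain ⟨a, rfl⟩ := Algebra.trace_surjective F K x
  exact DFunLike.congr_fun h a

theorem sum_traceChar_mul [DecidableEq K] (hψ : ψ ≠ 1) (u : K) :
    ∑ a, traceChar ψ K (u * a) = if u = 0 then (Fintype.card K : ℂ) else 0 := by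
  simp only [mul_comm u]
  rw [AddChar.sum_mulShift u (isPrimitive_traceChar ψ hψ)]
  split_ifs <;> simp

end TraceCharacter

/-! ### Character sums over pairs with prescribed norm ratio -/

section CharacterSums

variable {F K L : Type*} [Field F] [Field K] [Field L] [Fintype F] [Fintype K] [Fintype L]
  [Algebra F K] [Algebra F L] [DecidableEq F] [DecidableEq K] (ψ : AddChar F ℂ)

/-- The character sum over the pairs `(a, b)` with `a ≠ 0` and `N(b) = z N(a)`. -/
noncomputable def normPairSum (z : F) (u : K) (v : L) : ℂ :=
  ∑ a : K, if a = 0 then 0 else traceChar ψ K (u * a) *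
    ∑ b : L, if Algebra.norm F b = z * Algebra.norm F a then traceChar ψ L (v * b) else 0

variable {ψ}

omit [DecidableEq F] [DecidableEq K] in
theorem normFibreCard_succ [DecidableEq F] (hKL : Module.finrank F L = Module.finrank F K + 1) :
    (normFibreCard F L : ℂ) = Fintype.card K + normFibreCard F K := by
  have h1 := normFibreCard_mul (F := F) (K := K)
  have h2 := normFibreCard_mul (F := F) (K := L)
  have hL : (Fintype.card L : ℂ) = Fintype.card K * Fintype.card F := by
    rw [Module.card_eq_pow_finrank (K := F) (V := L), hKL, pow_succ,
      ← Module.card_eq_pow_finrank (K := F) (V := K)]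
    push_cast
    rfl
  have hQ : (Fintype.card F : ℂ) - 1 ≠ 0 := by
    rw [sub_ne_zero]
    exact_mod_cast (Fintype.one_lt_card (α := F)).ne'
  refine mul_right_cancel₀ hQ ?_
  rw [h2, hL, add_mul, h1]
  ring

omit [DecidableEq F] in
theorem sum_ne_zero_traceChar_mul (hψ : ψ ≠ 1) (u : K) :
    ∑ a : K, (if a = 0 then 0 else traceChar ψ K (u * a)) =
      (if u = 0 then (Fintype.card K : ℂ) else 0) - 1 := by
  rw [← sum_traceChar_mul ψ hψ u, eq_sub_iff_add_eq]
  have h1 : (1 : ℂ) = ∑ a : K, if a = 0 then (1 : ℂ) else 0 := by simp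
  rw [h1, ← Finset.sum_add_distrib]
  refine Finset.sum_congr rfl fun a _ => ?_
  split_ifs with h <;> simp [h]

theorem normPairSum_zero (hψ : ψ ≠ 1) (u : K) (v : L) :
    normPairSum ψ 0 u v = (if u = 0 then (Fintype.card K : ℂ) else 0) - 1 := by
  classical
  rw [← sum_ne_zero_traceChar_mul hψ u, normPairSum]
  refine Finset.sum_congr rfl fun a _ => ?_
  simp only [zero_mul, Algebra.norm_eq_zero_iff, Finset.sum_ite_eq', Finset.mem_univ, if_true,
    mul_zero, AddChar.map_zero_eq_one, mul_one]

/-- Davenport-Hasse replaces `b` by a pair in `K × F`. Writing its first entry as `a t` forces the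
second to be `z / N(t)`, and summing over `a ≠ 0` gives `|K|` at `t = 1` minus `1` at every `t ≠ 0`.
-/
theorem normPairSum_neg_one_one (hψ : ψ ≠ 1)
    (hKL : Module.finrank F L = Module.finrank F K + 1) {z : F} (hz : z ≠ 0) :
    normPairSum ψ z (-1 : K) (1 : L) = -(Fintype.card K * ψ z) - normFibreCard F K := by
  have hinner : ∀ a : K, a ≠ 0 →
      (∑ b : L, if Algebra.norm F b = z * Algebra.norm F a then traceChar ψ L (1 * b) else 0) =
        -∑ t : K, if t = 0 then 0 else traceChar ψ K (a * t) * ψ (z / Algebra.norm F t) := by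
    intro a ha
    have hNa : Algebra.norm F a ≠ 0 := Algebra.norm_ne_zero_iff.2 ha
    simp only [one_mul, traceChar_apply]
    rw [sum_norm_eq_of_finrank_succ ψ (K := K) hψ hKL]
    congr 1
    refine (Fintype.sum_equiv (Equiv.mulLeft₀ a ha) _ _ fun t => ?_).symm
    rw [Equiv.mulLeft₀_apply]
    split_ifs with ht
    · subst ht
      simp [hz, hNa, eq_comm (a := (0 : F))]
    · have hNt : Algebra.norm F t ≠ 0 := Algebra.norm_ne_zero_iff.2 ht
      have hiff : ∀ c : F, Algebra.norm F (a * t) * c = z * Algebra.norm F a ↔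
          c = z / Algebra.norm F t := fun c => by
        rw [map_mul, eq_div_iff hNt, mul_comm z, mul_assoc, mul_right_inj' hNa, mul_comm c]
      simp only [hiff, Finset.sum_ite_eq', Finset.mem_univ, if_true]
  have hstep : normPairSum ψ z (-1 : K) (1 : L) =
      -∑ t : K, if t = 0 then 0 else ψ (z / Algebra.norm F t) *
        ∑ a : K, if a = 0 then 0 else traceChar ψ K ((t - 1) * a) := by
    rw [normPairSum]
    calc _ = ∑ a : K, -∑ t : K, if t = 0 then 0 else ψ (z / Algebra.norm F t) *
          if a = 0 then 0 else traceChar ψ K ((t - 1) * a) := by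
          refine Finset.sum_congr rfl fun a _ => ?_
          by_cases ha : a = 0
          · simp [ha]
          · rw [if_neg ha, hinner a ha, mul_neg, Finset.mul_sum]
            congr 1
            refine Finset.sum_congr rfl fun t _ => ?_
            split_ifs
            · rw [mul_zero]
            · rw [← mul_assoc, ← AddChar.map_add_eq_mul, mul_comm]
              congr 2
              ring
      _ = _ := by
          rw [Finset.sum_neg_distrib, Finset.sum_comm]
          congr 1
          refine Finset.sum_congr rfl fun t _ => ?_
          split_ifs
          · simp
          · rw [Finset.mul_sum]
  have hψ0 : ∑ y : F, ψ y = 0 := AddChar.sum_eq_zero_of_ne_one hψ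
  have hlast : ∑ t : K, (if t = 0 then 0 else ψ (z / Algebra.norm F t)) =
      -(normFibreCard F K : ℂ) := by
    have h := sum_comp_norm (K := K) (fun y : F => if y = 0 then (0 : ℂ) else ψ (z / y)) (by simp)
    simp only [Algebra.norm_eq_zero_iff] at h
    rw [h]
    have hsum : ∑ y : F, (if y = 0 then (0 : ℂ) else ψ (z / y)) = -1 := by
      have h1 : ∑ y : F, (if y = 0 then (0 : ℂ) else ψ (z / y)) =
          ∑ y : F, if y = 0 then (0 : ℂ) else ψ y := by
        -- As division by zero yields zero, `y ↦ z / y` is an involution of all of `F` fixing `0`.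
        refine Finset.sum_nbij' (fun y => z / y) (fun y => z / y) (by simp) (by simp)
          (fun y _ => div_div_cancel₀ hz) (fun y _ => div_div_cancel₀ hz) fun y _ => ?_
        simp [div_eq_zero_iff, hz]
      have h2 : ∑ y : F, ψ y = ∑ y : F, ((if y = 0 then (0 : ℂ) else ψ y) +
          if y = 0 then 1 else 0) := by
        refine Finset.sum_congr rfl fun y _ => ?_
        split_ifs with hy <;> simp [hy]
      rw [h1]
      rw [hψ0, Finset.sum_add_distrib] at h2
      simp only [Finset.sum_ite_eq', Finset.mem_univ, if_true] at h2
      linear_combination -h2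
    rw [hsum]
    ring
  rw [hstep]
  have hterm : ∀ t : K, (if t = 0 then 0 else ψ (z / Algebra.norm F t) *
      ∑ a : K, if a = 0 then 0 else traceChar ψ K ((t - 1) * a)) =
      (if t = 1 then (Fintype.card K : ℂ) * ψ z else 0) -
        if t = 0 then 0 else ψ (z / Algebra.norm F t) := by
    intro t
    rw [sum_ne_zero_traceChar_mul hψ]
    by_cases h0 : t = 0
    · simp [h0]
    · by_cases h1 : t = 1
      · simp [h1]
        ring
      · simp [h0, h1, sub_eq_zero]
  simp only [hterm, Finset.sum_sub_distrib, hlast, Finset.sum_ite_eq', Finset.mem_univ, if_true]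
  ring

omit [Fintype F] in
-- Substitute `-u a` for `a` and `v b` for `b`. The sign comes from normalising the first parameter
-- to `-1`, which puts `t - 1` in the previous evaluation.
theorem normPairSum_scale {u : K} {v : L} (hu : u ≠ 0) (hv : v ≠ 0) (z : F) :
    normPairSum ψ z u v =
      normPairSum ψ (z * (Algebra.norm F v / Algebra.norm F (-u))) (-1 : K) (1 : L) := by
  have hu' : -u ≠ 0 := neg_ne_zero.2 hu
  have hNu : Algebra.norm F (-u) ≠ 0 := Algebra.norm_ne_zero_iff.2 hu'
  have hNv : Algebra.norm F v ≠ 0 := Algebra.norm_ne_zero_iff.2 hv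
  unfold normPairSum
  refine Fintype.sum_equiv (Equiv.mulLeft₀ (-u) hu') _ _ fun a => ?_
  rw [Equiv.mulLeft₀_apply]
  simp only [mul_eq_zero, hu', false_or]
  split_ifs with ha
  · rfl
  · congr 1
    · congr 1
      ring
    · refine Fintype.sum_equiv (Equiv.mulLeft₀ v hv) _ _ fun b => ?_
      rw [Equiv.mulLeft₀_apply, one_mul]
      congr 1
      rw [map_mul, map_mul, eq_iff_iff]
      have h : z * (Algebra.norm F v / Algebra.norm F (-u)) *
          (Algebra.norm F (-u) * Algebra.norm F a) =
          Algebra.norm F v * (z * Algebra.norm F a) := by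
        field_simp
      rw [h, mul_right_inj' hNv]

theorem normPairSum_of_left_ne_zero (hψ : ψ ≠ 1)
    (hKL : Module.finrank F L = Module.finrank F K + 1) {z : F} (hz : z ≠ 0) {u : K} (hu : u ≠ 0)
    (v : L) : normPairSum ψ z u v =
      -(Fintype.card K * ψ (Algebra.norm F v / Algebra.norm F (-u) * z)) -
        normFibreCard F K := by
  have hNu : Algebra.norm F (-u) ≠ 0 := Algebra.norm_ne_zero_iff.2 (neg_ne_zero.2 hu)
  -- For `v = 0` the inner sum merely counts a norm fibre of `L`. Its size `|K| + n`, with `n` the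
  -- size for `K`, is what the general formula predicts with `ψ 0 = 1`.
  by_cases hv : v = 0
  · subst hv
    have hcount : ∀ a : K, a ≠ 0 → (∑ b : L, if Algebra.norm F b = z * Algebra.norm F a then
        traceChar ψ L (0 * b) else 0) = (normFibreCard F L : ℂ) := by
      intro a ha
      have hNa : Algebra.norm F a ≠ 0 := Algebra.norm_ne_zero_iff.2 ha
      rw [← card_filter_norm_eq (mul_ne_zero hz hNa), Finset.card_filter]
      push_cast
      simp
    have h : normPairSum ψ z u (0 : L) =
        (∑ a : K, if a = 0 then 0 else traceChar ψ K (u * a)) * normFibreCard F L := by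
      rw [normPairSum, Finset.sum_mul]
      refine Finset.sum_congr rfl fun a _ => ?_
      split_ifs with ha
      · rw [zero_mul]
      · rw [hcount a ha]
    rw [h, sum_ne_zero_traceChar_mul hψ, if_neg hu, normFibreCard_succ hKL]
    simp only [Algebra.norm_zero, zero_div, zero_mul, AddChar.map_zero_eq_one]
    ring
  · have hNv : Algebra.norm F v ≠ 0 := Algebra.norm_ne_zero_iff.2 hv
    rw [normPairSum_scale hu hv, normPairSum_neg_one_one hψ hKL
      (mul_ne_zero hz (div_ne_zero hNv hNu)), mul_comm z]

/-- With the sums exchanged, each `b ≠ 0` is paired with exactly one norm fibre of elements `a`, and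
`b = 0` with none. -/
theorem normPairSum_left_zero {z : F} (hz : z ≠ 0) (v : L) :
    normPairSum ψ z (0 : K) v =
      normFibreCard F K * ((∑ b : L, traceChar ψ L (v * b)) - 1) := by
  classical
  have h1 : normPairSum ψ z (0 : K) v = ∑ b : L, if b = 0 then 0 else
      traceChar ψ L (v * b) * normFibreCard F K := by
    have hcomm : normPairSum ψ z (0 : K) v = ∑ b : L, ∑ a : K,
        if a ≠ 0 ∧ Algebra.norm F b = z * Algebra.norm F a then traceChar ψ L (v * b) else 0 := by
      rw [normPairSum, Finset.sum_comm]
      refine Finset.sum_congr rfl fun a _ => ?_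
      by_cases ha : a = 0 <;> simp [ha]
    rw [hcomm]
    refine Finset.sum_congr rfl fun b _ => ?_
    split_ifs with hb
    · subst hb
      refine Finset.sum_eq_zero fun a _ => if_neg ?_
      rintro ⟨ha, h⟩
      rw [Algebra.norm_zero, zero_eq_mul] at h
      exact h.elim hz (Algebra.norm_ne_zero_iff.2 ha)
    · have hNb : Algebra.norm F b ≠ 0 := Algebra.norm_ne_zero_iff.2 hb
      have hiff : ∀ a : K, (a ≠ 0 ∧ Algebra.norm F b = z * Algebra.norm F a) ↔
          Algebra.norm F a = Algebra.norm F b / z := fun a => by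
        rw [eq_div_iff hz, mul_comm z, eq_comm (a := Algebra.norm F b)]
        refine ⟨fun h => h.2, fun h => ⟨?_, h⟩⟩
        rintro rfl
        rw [Algebra.norm_zero, zero_mul] at h
        exact hNb h.symm
      simp only [hiff]
      rw [← card_filter_norm_eq (K := K) (div_ne_zero hNb hz), Finset.card_filter]
      push_cast
      rw [Finset.mul_sum]
      simp
  have h2 : (1 : ℂ) = ∑ b : L, if b = 0 then (1 : ℂ) else 0 := by simp
  rw [h1, h2, ← Finset.sum_sub_distrib, Finset.mul_sum]
  refine Finset.sum_congr rfl fun b _ => ?_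
  split_ifs with hb
  · simp [hb]
  · ring

end CharacterSums

/-! ### The eigenvalues of the dual Denniston set -/

section Eigenvalues

variable {F K L : Type*} [Field F] [Field K] [Field L] [Algebra F K] [Algebra F L]

theorem mem_dualDennistonSet {W : Set F} {x : K × L} : x ∈ dualDennistonSet K L W ↔
    (x.1 ≠ 0 ∧ x.2 ≠ 0 ∧ Algebra.norm F x.2 / Algebra.norm F x.1 ∉ W) ∨
      (x.1 = 0 ∧ x.2 ≠ 0) := by
  simp [dualDennistonSet, Set.mem_prod]

theorem zero_notMem_dualDennistonSet (W : Set F) : (0 : K × L) ∉ dualDennistonSet K L W := by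
  simp [mem_dualDennistonSet]

theorem norm_neg_eq_or (a : K) :
    Algebra.norm F (-a) = Algebra.norm F a ∨ Algebra.norm F (-a) = -Algebra.norm F a := by
  have h : Algebra.norm F (-1 : K) * Algebra.norm F (-1 : K) = 1 := by
    rw [← map_mul]
    simp
  rw [neg_eq_neg_one_mul a, map_mul]
  rcases mul_self_eq_one_iff.1 h with h | h <;> simp [h]

theorem neg_mem_dualDennistonSet {W : AddSubgroup F} {x : K × L}
    (hx : x ∈ dualDennistonSet K L (W : Set F)) : -x ∈ dualDennistonSet K L (W : Set F) := by
  rw [mem_dualDennistonSet] at hx ⊢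
  simp only [Prod.fst_neg, Prod.snd_neg, neg_ne_zero, neg_eq_zero, SetLike.mem_coe] at hx ⊢
  refine hx.imp_left fun ⟨h1, h2, h3⟩ => ⟨h1, h2, ?_⟩
  rcases norm_neg_eq_or (F := F) x.1 with h | h <;>
    rcases norm_neg_eq_or (F := F) x.2 with h' | h' <;>
      simpa [h, h', neg_div, div_neg] using h3

theorem neg_dualDennistonSet (W : AddSubgroup F) :
    -dualDennistonSet K L (W : Set F) = dualDennistonSet K L (W : Set F) := by
  ext x
  rw [Set.mem_neg]
  exact ⟨fun h => by simpa using neg_mem_dualDennistonSet h, neg_mem_dualDennistonSet⟩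

theorem dualDennistonSet_nonempty (W : Set F) : (dualDennistonSet K L W).Nonempty :=
  ⟨(0, 1), mem_dualDennistonSet.2 (Or.inr ⟨rfl, one_ne_zero⟩)⟩

theorem exists_ne_zero_notMem_dualDennistonSet (W : Set F) :
    ∃ x : K × L, x ≠ 0 ∧ x ∉ dualDennistonSet K L W :=
  ⟨(1, 0), by simp, by simp [mem_dualDennistonSet]⟩

/-- The characters `(a, b) ↦ ψ(Tr(ua) + Tr(vb))` of `K × L`. -/
noncomputable def prodChar (ψ : AddChar F ℂ) (i : K × L) : AddChar (K × L) ℂ :=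
  (((traceChar ψ K).mulShift i.1).compAddMonoidHom (AddMonoidHom.fst K L)) *
    (((traceChar ψ L).mulShift i.2).compAddMonoidHom (AddMonoidHom.snd K L))

theorem prodChar_apply (ψ : AddChar F ℂ) (i x : K × L) :
    prodChar ψ i x = traceChar ψ K (i.1 * x.1) * traceChar ψ L (i.2 * x.2) := rfl

theorem prodChar_zero (ψ : AddChar F ℂ) : prodChar ψ (0 : K × L) = 1 := by
  ext x
  simp [prodChar_apply]

variable [Fintype F] [Fintype K] [Fintype L]

theorem sum_prodChar [DecidableEq K] [DecidableEq L] {ψ : AddChar F ℂ} (hψ : ψ ≠ 1) (x : K × L) :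
    ∑ i, prodChar ψ i x = if x = 0 then (Fintype.card (K × L) : ℂ) else 0 := by
  obtain ⟨a, b⟩ := x
  simp only [prodChar_apply, Fintype.sum_prod_type, ← Finset.mul_sum, ← Finset.sum_mul]
  simp only [mul_comm _ a, mul_comm _ b]
  rw [sum_traceChar_mul ψ hψ, sum_traceChar_mul ψ hψ]
  by_cases ha : a = 0 <;> by_cases hb : b = 0 <;> simp [ha, hb]

variable [DecidableEq F] [DecidableEq K] (W : AddSubgroup F)

open Classical in
-- The complement is the origin together with the pairs with `a ≠ 0` whose norm ratio is some `w` in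
-- `W`, and this `w` is unique. The pairs with `b = 0` belong to `w = 0`.
theorem sum_compl_prodChar (ψ : AddChar F ℂ) (i : K × L) :
    ∑ x with x ∉ dualDennistonSet K L (W : Set F), prodChar ψ i x =
      1 + ∑ w : W, normPairSum ψ (w : F) i.1 i.2 := by
  have hind : ∀ (a : K) (b : L),
      (if (a, b) ∉ dualDennistonSet K L (W : Set F) then prodChar ψ i (a, b) else 0) =
      (if a = 0 then if b = 0 then 1 else 0 else 0) +
        ∑ w : W, if a = 0 then 0 else traceChar ψ K (i.1 * a) *
          if Algebra.norm F b = w * Algebra.norm F a then traceChar ψ L (i.2 * b) else 0 := by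
    intro a b
    rw [mem_dualDennistonSet]
    by_cases ha : a = 0
    · by_cases hb : b = 0 <;> simp [ha, hb, prodChar_apply]
    · have hNa : Algebra.norm F a ≠ 0 := Algebra.norm_ne_zero_iff.2 ha
      simp only [ha, if_false, ne_eq, not_false_eq_true, true_and, false_and, or_false, zero_add,
        prodChar_apply, SetLike.mem_coe]
      have hb0 : ¬(¬b = 0 ∧ Algebra.norm F b / Algebra.norm F a ∉ W) ↔
          Algebra.norm F b / Algebra.norm F a ∈ W := by
        by_cases hb : b = 0
        · simp [hb, W.zero_mem]
        · simp [hb]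
      simp only [hb0, ← eq_div_iff_mul_eq hNa, eq_comm (a := Algebra.norm F b)]
      rw [← Finset.mul_sum]
      split_ifs with hW
      · rw [Finset.sum_eq_single_of_mem (⟨_, hW⟩ : W) (Finset.mem_univ _), if_pos rfl]
        intro w _ hw
        exact if_neg fun h => hw (Subtype.ext h)
      · rw [Finset.sum_eq_zero, mul_zero]
        intro w _
        refine if_neg fun h => hW ?_
        rw [← h]
        exact w.2
  rw [Finset.sum_filter, Fintype.sum_prod_type]
  simp only [hind, Finset.sum_add_distrib]
  congr 1
  · simp
  · simp only [normPairSum]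
    rw [Finset.sum_comm]
    have h : ∀ a : K, ∑ b : L, ∑ w : W, (if a = 0 then 0 else traceChar ψ K (i.1 * a) *
          if Algebra.norm F b = w * Algebra.norm F a then traceChar ψ L (i.2 * b) else 0) =
        ∑ w : W, if a = 0 then 0 else traceChar ψ K (i.1 * a) *
          ∑ b : L, if Algebra.norm F b = w * Algebra.norm F a
            then traceChar ψ L (i.2 * b) else 0 := fun a => by
      rw [Finset.sum_comm]
      refine Finset.sum_congr rfl fun w _ => ?_
      split_ifs
      · simp
      · rw [Finset.mul_sum]
    rw [Finset.sum_comm, Finset.sum_comm (γ := W)]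
    exact Finset.sum_congr rfl fun a _ => h a

omit [Fintype F] [DecidableEq F] in
theorem sum_addSubgroup_eq (ψ : AddChar F ℂ) [Fintype W] (c : F) :
    ∑ w : W, ψ (c * w) = 0 ∨ ∑ w : W, ψ (c * w) = Fintype.card W := by
  let χ : AddChar W ℂ := (ψ.mulShift c).compAddMonoidHom W.subtype
  have h : ∑ w : W, ψ (c * w) = ∑ w, χ w := rfl
  rw [h]
  by_cases hχ : χ = 1
  · exact Or.inr (AddChar.sum_eq_card_of_eq_one hχ)
  · exact Or.inl (AddChar.sum_eq_zero_of_ne_one hχ)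

omit [Fintype F] in
-- The closed formulas hold only for `z ≠ 0`, so the term at `w = 0` is corrected separately.
theorem sum_normPairSum_of_formula {ψ : AddChar F ℂ} [Fintype W] {u : K} {v : L} (g : F → ℂ)
    (hg : ∀ z, z ≠ 0 → normPairSum ψ z u v = g z) :
    ∑ w : W, normPairSum ψ (w : F) u v =
      ∑ w : W, g w + (normPairSum ψ 0 u v - g 0) := by
  classical
  have h : ∀ w : W, normPairSum ψ (w : F) u v =
      g w + if w = 0 then normPairSum ψ 0 u v - g 0 else 0 := fun w => by
    split_ifs with hw
    · simp [hw]
    · rw [hg _ fun h => hw (Subtype.ext h), add_zero]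
  simp only [h, Finset.sum_add_distrib, Finset.sum_ite_eq', Finset.mem_univ, if_true]

variable (hKL : Module.finrank F L = Module.finrank F K + 1)
include hKL

open Classical in
-- The sum over `D` is minus the sum over the complement. If `u = 0` the first value results; if `u
-- ≠ 0` the alternative is whether `w ↦ ψ(cw)` is nontrivial or trivial on `W`, where `c =
-- N(v)/N(-u)`.
theorem dualDennistonSet_eigenvalues {ψ : AddChar F ℂ} (hψ : ψ ≠ 1) {i : K × L} (hi : i ≠ 0) :
    (∑ x with x ∈ dualDennistonSet K L (W : Set F), prodChar ψ i x =
      -(Fintype.card K : ℂ) + (Fintype.card W - 1) * normFibreCard F K) ∨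
    (∑ x with x ∈ dualDennistonSet K L (W : Set F), prodChar ψ i x =
      Fintype.card K * (Fintype.card W - 1) + (Fintype.card W - 1) * normFibreCard F K) := by
  have htotal : ∑ x, prodChar ψ i x = 0 := by
    have h := sum_prodChar hψ i
    rw [if_neg hi] at h
    rw [← h]
    refine Finset.sum_congr rfl fun x _ => ?_
    rw [prodChar_apply, prodChar_apply, mul_comm i.1, mul_comm i.2]
  have hD : ∑ x with x ∈ dualDennistonSet K L (W : Set F), prodChar ψ i x =
      -(1 + ∑ w : W, normPairSum ψ (w : F) i.1 i.2) := by
    rw [← sum_compl_prodChar, eq_neg_iff_add_eq_zero, Finset.sum_filter_add_sum_filter_not, htotal]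
  rw [hD]
  by_cases hu : i.1 = 0
  · have hv : i.2 ≠ 0 := fun hv => hi (Prod.ext hu hv)
    left
    rw [sum_normPairSum_of_formula W (fun _ => -(normFibreCard F K : ℂ)) fun z hz => by
      rw [hu, normPairSum_left_zero hz, sum_traceChar_mul ψ hψ, if_neg hv]
      ring]
    rw [normPairSum_zero hψ, if_pos hu]
    simp only [Finset.sum_const, Finset.card_univ, nsmul_eq_mul]
    ring
  · rw [sum_normPairSum_of_formula W (fun z => -(Fintype.card K *
      ψ (Algebra.norm F i.2 / Algebra.norm F (-i.1) * z)) - (normFibreCard F K : ℂ)) fun z hz =>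
        normPairSum_of_left_ne_zero hψ hKL hz hu i.2]
    rw [normPairSum_zero hψ, if_neg hu]
    simp only [Finset.sum_sub_distrib, Finset.sum_neg_distrib, ← Finset.mul_sum,
      Finset.sum_const, Finset.card_univ, nsmul_eq_mul, mul_zero, AddChar.map_zero_eq_one]
    rcases sum_addSubgroup_eq W ψ (Algebra.norm F i.2 / Algebra.norm F (-i.1)) with h | h
    · left
      rw [h]
      ring
    · right
      rw [h]
      ring

omit hKL in
open Classical in
-- The size of the complement is its character sum at the trivial character, so the evaluations for
-- `u = v = 0` give it.
theorem ncard_dualDennistonSet :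
    ((dualDennistonSet K L (W : Set F)).ncard : ℂ) = Fintype.card K * Fintype.card L -
      (Fintype.card K + (Fintype.card W - 1) * normFibreCard F K * (Fintype.card L - 1)) := by
  obtain ⟨ψ, hψ⟩ : ∃ ψ : AddChar F ℂ, ψ ≠ 1 := by
    obtain ⟨ψ, hψ⟩ := AddChar.exists_apply_ne_zero (α := F) |>.2 (one_ne_zero (α := F))
    exact ⟨ψ, fun h => hψ (by rw [h]; rfl)⟩
  have hcoe : dualDennistonSet K L (W : Set F) =
      ((Finset.univ.filter fun x => x ∈ dualDennistonSet K L (W : Set F) :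
        Finset (K × L)) : Set (K × L)) := by simp
  rw [hcoe, Set.ncard_coe_finset]
  have h1 := sum_compl_prodChar (K := K) (L := L) W ψ 0
  rw [sum_normPairSum_of_formula W (fun _ => (normFibreCard F K : ℂ) * (Fintype.card L - 1))
    fun z hz => by rw [Prod.fst_zero, normPairSum_left_zero hz, sum_traceChar_mul ψ hψ,
      Prod.snd_zero, if_pos rfl], normPairSum_zero hψ, Prod.fst_zero, if_pos rfl] at h1
  simp only [prodChar_zero, AddChar.one_apply, Finset.sum_const, Finset.card_univ,
    nsmul_eq_mul, mul_one] at h1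
  have h2 : ((Finset.univ.filter fun x => x ∈ dualDennistonSet K L (W : Set F)).card : ℂ) +
      ((Finset.univ.filter fun x => x ∉ dualDennistonSet K L (W : Set F)).card : ℂ) =
      Fintype.card K * Fintype.card L := by
    rw [← Nat.cast_add, Finset.card_filter_add_card_filter_not, Finset.card_univ,
      Fintype.card_prod, Nat.cast_mul]
  rw [h1] at h2
  linear_combination h2

open Classical in
theorem ncard_differences_dualDennistonSet (d : K × L) (hd : d ≠ 0) :
    ((Fintype.card K : ℂ) * Fintype.card L) *
        {x : (K × L) × (K × L) | x.1 ∈ dualDennistonSet K L (W : Set F) ∧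
          x.2 ∈ dualDennistonSet K L (W : Set F) ∧ x.1 ≠ x.2 ∧ x.1 - x.2 = d}.ncard =
      (Fintype.card K * Fintype.card L) * (if d ∈ dualDennistonSet K L (W : Set F) then
        Fintype.card K * ((Fintype.card W : ℂ) - 2) +
          2 * (Fintype.card W - 1) * normFibreCard F K else 0) +
        (((dualDennistonSet K L (W : Set F)).ncard : ℂ) ^ 2 -
          (Fintype.card K * ((Fintype.card W : ℂ) - 2) +
            2 * (Fintype.card W - 1) * normFibreCard F K) *
            (dualDennistonSet K L (W : Set F)).ncard +
          (-(Fintype.card K : ℂ) + (Fintype.card W - 1) * normFibreCard F K) *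
            (Fintype.card K * (Fintype.card W - 1) +
              (Fintype.card W - 1) * normFibreCard F K)) := by
  obtain ⟨ψ, hψ⟩ : ∃ ψ : AddChar F ℂ, ψ ≠ 1 := by
    obtain ⟨ψ, hψ⟩ := AddChar.exists_apply_ne_zero (α := F) |>.2 (one_ne_zero (α := F))
    exact ⟨ψ, fun h => hψ (by rw [h]; rfl)⟩
  have hcoe : dualDennistonSet K L (W : Set F) =
      ((Finset.univ.filter fun x => x ∈ dualDennistonSet K L (W : Set F) :
        Finset (K × L)) : Set (K × L)) := by simp
  have h := ncard_differences_of_eigenvalues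
    (Finset.univ.filter fun x => x ∈ dualDennistonSet K L (W : Set F))
    (fun x hx => by simpa using neg_mem_dualDennistonSet (by simpa using hx))
    (prodChar ψ) 0 (prodChar_zero ψ) (fun x => by convert sum_prodChar hψ x) _ _
    (fun i hi => dualDennistonSet_eigenvalues W hKL hψ hi) d hd
  rw [← Set.ncard_coe_finset, ← hcoe] at h
  simp only [Finset.mem_filter, Finset.mem_univ, true_and, Fintype.card_prod, Nat.cast_mul] at h
  rw [h]
  split_ifs <;> ring

end Eigenvalues

/-! ### Cyclotomic classes and norms of primitive elements -/

section CyclotomicClasses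

theorem mem_cyclotomicClass_iff {K : Type*} [Field K] {α : Kˣ} {e i : ℕ} {x : K} :
    x ∈ cyclotomicClass α e i ↔ ∃ j : ℤ, x = ((α ^ ((i : ℤ) + e * j) : Kˣ) : K) := by
  constructor
  · rintro ⟨u, hu, rfl⟩
    obtain ⟨j, rfl⟩ := Subgroup.mem_zpowers_iff.1 hu
    exact ⟨j, by rw [zpow_add, zpow_mul, zpow_natCast, zpow_natCast]⟩
  · rintro ⟨j, rfl⟩
    exact ⟨(α ^ e) ^ j, Subgroup.zpow_mem_zpowers _ _, by
      rw [zpow_add, zpow_mul, zpow_natCast, zpow_natCast]⟩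

theorem ne_zero_of_mem_cyclotomicClass {K : Type*} [Field K] {α : Kˣ} {e i : ℕ} {x : K}
    (hx : x ∈ cyclotomicClass α e i) : x ≠ 0 := by
  obtain ⟨j, rfl⟩ := mem_cyclotomicClass_iff.1 hx
  exact Units.ne_zero _

theorem IsPrimitiveElement.exists_zpow_eq {K : Type*} [Field K] {α : Kˣ}
    (hα : IsPrimitiveElement α) {x : K} (hx : x ≠ 0) : ∃ n : ℤ, x = ((α ^ n : Kˣ) : K) := by
  have h : Units.mk0 x hx ∈ Subgroup.zpowers α := by
    rw [show Subgroup.zpowers α = ⊤ from hα]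
    trivial
  obtain ⟨n, hn⟩ := Subgroup.mem_zpowers_iff.1 h
  exact ⟨n, by rw [hn, Units.val_mk0]⟩

theorem IsPrimitiveElement.exists_mem_cyclotomicClass {K : Type*} [Field K] {α : Kˣ}
    (hα : IsPrimitiveElement α) {e : ℕ} (he : 0 < e) {x : K} (hx : x ≠ 0) :
    ∃ t < e, x ∈ cyclotomicClass α e t := by
  obtain ⟨n, rfl⟩ := hα.exists_zpow_eq hx
  have he' : (e : ℤ) ≠ 0 := by exact_mod_cast he.ne'
  have h0 := Int.emod_nonneg n he'
  have h1 := Int.emod_lt_of_pos n (show (0 : ℤ) < e by exact_mod_cast he)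
  refine ⟨(n % e).toNat, by omega, mem_cyclotomicClass_iff.2 ⟨n / e, ?_⟩⟩
  rw [Int.toNat_of_nonneg h0, Int.emod_add_mul_ediv]

variable {F : Type*} [Field F] {γ : Fˣ} {e : ℕ} {W : Set F}

theorem mem_iff_of_mem_cyclotomicClass
    (hW : ∀ u ∈ Subgroup.zpowers (γ ^ e), ∀ w ∈ W, ((u : Fˣ) : F) * w ∈ W) {t : ℕ} {z : F}
    (hz : z ∈ cyclotomicClass γ e t) : z ∈ W ↔ ((γ ^ t : Fˣ) : F) ∈ W := by
  obtain ⟨u, hu, rfl⟩ := hz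
  constructor
  · intro h
    have h1 := hW u⁻¹ (inv_mem hu) _ h
    rwa [← Units.val_mul, mul_comm (γ ^ t), inv_mul_cancel_left] at h1
  · intro h
    have h1 := hW u hu _ h
    rwa [← Units.val_mul, mul_comm] at h1

theorem mem_iUnion_cyclotomicClass_exponentSet (hγ : IsPrimitiveElement γ) (he : 0 < e)
    (hW : ∀ u ∈ Subgroup.zpowers (γ ^ e), ∀ w ∈ W, ((u : Fˣ) : F) * w ∈ W) {z : F} :
    z ∈ ⋃ t ∈ exponentSet γ e W, cyclotomicClass γ e t ↔ z ≠ 0 ∧ z ∈ W := by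
  simp only [Set.mem_iUnion, exists_prop]
  constructor
  · rintro ⟨t, ⟨-, ht⟩, hz⟩
    exact ⟨ne_zero_of_mem_cyclotomicClass hz, (mem_iff_of_mem_cyclotomicClass hW hz).2 ht⟩
  · rintro ⟨hz0, hz⟩
    obtain ⟨t, hte, ht⟩ := hγ.exists_mem_cyclotomicClass he hz0
    exact ⟨t, ⟨hte, (mem_iff_of_mem_cyclotomicClass hW ht).1 hz⟩, ht⟩

theorem mem_iUnion_cyclotomicClass_diff_exponentSet (hγ : IsPrimitiveElement γ) (he : 0 < e)
    (hW : ∀ u ∈ Subgroup.zpowers (γ ^ e), ∀ w ∈ W, ((u : Fˣ) : F) * w ∈ W) {z : F} :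
    z ∈ ⋃ t ∈ Set.Iio e \ exponentSet γ e W, cyclotomicClass γ e t ↔ z ≠ 0 ∧ z ∉ W := by
  simp only [Set.mem_iUnion, exists_prop]
  constructor
  · rintro ⟨t, ⟨hte, ht⟩, hz⟩
    exact ⟨ne_zero_of_mem_cyclotomicClass hz,
      fun h => ht ⟨hte, (mem_iff_of_mem_cyclotomicClass hW hz).1 h⟩⟩
  · rintro ⟨hz0, hz⟩
    obtain ⟨t, hte, ht⟩ := hγ.exists_mem_cyclotomicClass he hz0
    exact ⟨t, ⟨hte, fun h => hz ((mem_iff_of_mem_cyclotomicClass hW ht).2 h.2)⟩, ht⟩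

theorem norm_zpow_units {K : Type*} [Field K] [Algebra F K] {α : Kˣ}
    (hα : Algebra.norm F (α : K) = γ) (n : ℤ) :
    Algebra.norm F ((α ^ n : Kˣ) : K) = ((γ ^ n : Fˣ) : F) := by
  have h : Units.map (Algebra.norm F : K →* F) α = γ := Units.ext hα
  rw [← h, ← map_zpow]
  rfl

/-- Norms turn exponents of `α` and `β` into exponents of `γ`. These are determined modulo the order
of `γ`, hence modulo its divisor `e`, and a class of order `e` depends only on the exponent modulo
`e`. -/
theorem mem_cyclotomicUnion_iff {K L : Type*} [Field K] [Field L] [Algebra F K] [Algebra F L]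
    {α : Kˣ} {β : Lˣ} (hα : IsPrimitiveElement α) (hβ : IsPrimitiveElement β)
    (hNα : Algebra.norm F (α : K) = γ) (hNβ : Algebra.norm F (β : L) = γ) (he : 0 < e)
    (hord : e ∣ orderOf γ) {T : Set ℕ} {x : K × L} :
    x ∈ cyclotomicUnion α β e T ↔ x.1 ≠ 0 ∧ x.2 ≠ 0 ∧
      Algebra.norm F x.2 / Algebra.norm F x.1 ∈ ⋃ t ∈ T, cyclotomicClass γ e t := by
  obtain ⟨a, b⟩ := x
  simp only [cyclotomicUnion, Set.mem_iUnion, Set.mem_prod, exists_prop, Set.mem_Iio]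
  constructor
  · rintro ⟨i, -, hi, t, ht, hb⟩
    refine ⟨ne_zero_of_mem_cyclotomicClass hi, ne_zero_of_mem_cyclotomicClass hb, t, ht, ?_⟩
    obtain ⟨j, rfl⟩ := mem_cyclotomicClass_iff.1 hi
    obtain ⟨k, rfl⟩ := mem_cyclotomicClass_iff.1 hb
    refine mem_cyclotomicClass_iff.2 ⟨k - j, ?_⟩
    rw [norm_zpow_units hNα, norm_zpow_units hNβ, ← Units.val_div_eq_div_val, div_eq_mul_inv,
      ← zpow_sub]
    congr 2
    push_cast
    ring
  · rintro ⟨ha, hb, t, ht, hab⟩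
    obtain ⟨i, hie, hi⟩ := hα.exists_mem_cyclotomicClass he ha
    refine ⟨i, hie, hi, t, ht, ?_⟩
    obtain ⟨j, rfl⟩ := mem_cyclotomicClass_iff.1 hi
    obtain ⟨k, rfl⟩ := hβ.exists_zpow_eq hb
    obtain ⟨c, hc⟩ := mem_cyclotomicClass_iff.1 hab
    rw [norm_zpow_units hNα, norm_zpow_units hNβ, ← Units.val_div_eq_div_val, div_eq_mul_inv,
      ← zpow_sub] at hc
    have h1 : γ ^ (k - (i + e * j) - (t + e * c)) = 1 := by
      rw [zpow_sub, Units.ext hc, mul_inv_cancel]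
    have h2 : (e : ℤ) ∣ k - (i + e * j) - (t + e * c) :=
      (Int.natCast_dvd_natCast.2 hord).trans (orderOf_dvd_iff_zpow_eq_one.2 h1)
    obtain ⟨d, hd⟩ := h2
    refine mem_cyclotomicClass_iff.2 ⟨d + j + c, ?_⟩
    congr 2
    push_cast
    linear_combination hd

/-- A generator of the image of a finite cyclic group lifts to a generator. -/
theorem exists_zpowers_eq_top_of_surjective {G H : Type*} [Group G] [Group H] [Finite G]
    [IsCyclic G] (f : G →* H) (hf : Function.Surjective f) {γ : H}
    (hγ : Subgroup.zpowers γ = ⊤) : ∃ α : G, Subgroup.zpowers α = ⊤ ∧ f α = γ := by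
  have hH : Finite H := Finite.of_surjective f hf
  obtain ⟨g, hg⟩ := IsCyclic.exists_generator (α := G)
  have hgtop : Subgroup.zpowers g = ⊤ := (Subgroup.eq_top_iff' _).2 hg
  have hordg : orderOf g = Nat.card G := orderOf_eq_card_of_zpowers_eq_top hgtop
  have hfg : ∀ y : H, y ∈ Subgroup.zpowers (f g) := fun y => by
    obtain ⟨x, rfl⟩ := hf y
    obtain ⟨n, rfl⟩ := Subgroup.mem_zpowers_iff.1 (hg x)
    exact Subgroup.mem_zpowers_iff.2 ⟨n, (map_zpow f g n).symm⟩
  have hordfg : orderOf (f g) = Nat.card H :=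
    orderOf_eq_card_of_zpowers_eq_top ((Subgroup.eq_top_iff' _).2 hfg)
  have hordγ : orderOf γ = Nat.card H := orderOf_eq_card_of_zpowers_eq_top hγ
  obtain ⟨k, hk⟩ := (mem_powers_iff_mem_zpowers).2 (hfg γ)
  simp only at hk
  have hcop : Nat.Coprime k (Nat.card H) := by
    have h1 : orderOf (f g ^ k) = orderOf (f g) := by rw [hk, hordγ, hordfg]
    rw [orderOf_pow, hordfg] at h1
    have hpos : 0 < Nat.card H := Nat.card_pos
    rcases Nat.div_eq_self.1 h1 with h | h
    · omega
    · rwa [Nat.gcd_comm] at h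
  have hdvd : Nat.card H ∣ Nat.card G := by
    rw [← hordfg, ← hordg]
    exact orderOf_map_dvd f g
  have hne : NeZero (Nat.card G) := ⟨Nat.card_pos.ne'⟩
  -- The exponent `k` is coprime to `|H|` only; lifting it to a unit modulo `|G|` makes the power of
  -- `g` a generator without changing its image.
  obtain ⟨u, hu⟩ := ZMod.unitsMap_surjective hdvd (ZMod.unitOfCoprime k hcop)
  have hval : (((u : ZMod (Nat.card G)).val : ℕ) : ZMod (Nat.card H)) = k := by
    have h1 := congrArg (fun v : (ZMod (Nat.card H))ˣ => (v : ZMod (Nat.card H))) hu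
    simp only [ZMod.coe_unitOfCoprime] at h1
    rw [← h1, ZMod.unitsMap_val, ZMod.natCast_val]
  refine ⟨g ^ (u : ZMod (Nat.card G)).val, ?_, ?_⟩
  · refine Subgroup.eq_top_of_card_eq _ ?_
    rw [Nat.card_zpowers, orderOf_pow, hordg, Nat.gcd_comm,
      Nat.Coprime.gcd_eq_one (ZMod.val_coe_unit_coprime u), Nat.div_one]
  · rw [map_pow, ← hk, pow_eq_pow_iff_modEq, hordfg]
    exact (ZMod.natCast_eq_natCast_iff _ _ _).1 hval

theorem exists_isPrimitiveElement_norm_eq [Finite F] {K : Type*} [Field K] [Finite K] [Algebra F K]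
    (hγ : IsPrimitiveElement γ) :
    ∃ α : Kˣ, IsPrimitiveElement α ∧ Algebra.norm F (α : K) = γ := by
  obtain ⟨α, hα, h⟩ := exists_zpowers_eq_top_of_surjective
    (Units.map (Algebra.norm F (S := K))) (FiniteField.unitsMap_norm_surjective F K) hγ
  exact ⟨α, hα, congrArg Units.val h⟩

theorem mem_range_algebraMap_of_pow_card_eq {E : Type*} [Field E] [Fintype E] [Finite F]
    [Algebra E F] {x : F} (hx : x ^ Fintype.card E = x) : x ∈ Set.range (algebraMap E F) := by
  rw [IsGalois.mem_range_algebraMap_iff_fixed]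
  intro f
  obtain ⟨i, rfl⟩ := (FiniteField.bijective_frobeniusAlgEquivOfAlgebraic_pow E F).2 f
  have hfix : FiniteField.frobeniusAlgEquivOfAlgebraic E F x = x := by simpa using hx
  change (FiniteField.frobeniusAlgEquivOfAlgebraic E F ^ (i : ℕ)) x = x
  generalize (i : ℕ) = n
  induction n with
  | zero => simp
  | succ n ih => rw [pow_succ, AlgEquiv.mul_apply, hfix, ih]

/-- The hypothesis says that `γ ^ e` is fixed by `x ↦ x ^ |E|`, so it comes from `E`, and its powers
act as scalars. -/
theorem zpowers_smul_mem {E : Type*} [Field E] [Fintype E] [Finite F] [Algebra E F]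
    (R : Submodule E F) (hγ : γ ^ (e * (Fintype.card E - 1)) = 1) :
    ∀ u ∈ Subgroup.zpowers (γ ^ e), ∀ w ∈ (R : Set F), ((u : Fˣ) : F) * w ∈ (R : Set F) := by
  have hfix : ((γ ^ e : Fˣ) : F) ^ Fintype.card E = ((γ ^ e : Fˣ) : F) := by
    rw [← Units.val_pow_eq_pow_val]
    congr 1
    rw [← Nat.sub_add_cancel (Fintype.card_pos (α := E)), pow_succ, ← pow_mul, hγ, one_mul]
  obtain ⟨c, hc⟩ := mem_range_algebraMap_of_pow_card_eq (E := E) hfix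
  intro u hu w hw
  obtain ⟨n, rfl⟩ := Subgroup.mem_zpowers_iff.1 hu
  rw [Units.val_zpow_eq_zpow_val, ← hc, ← map_zpow₀, ← Algebra.smul_def]
  exact R.smul_mem _ hw

end CyclotomicClasses

/-! ### The trace dual and its dimensions -/

section TraceDual

theorem nonempty_addEquiv_of_card {p N : ℕ} [Fact p.Prime] {V : Type*} [AddCommGroup V] [Fintype V]
    [Module (ZMod p) V] (hV : Fintype.card V = p ^ N) : Nonempty (V ≃+ (Fin N → ZMod p)) := by
  have h : Module.finrank (ZMod p) V = N :=
    Nat.pow_right_injective (Fact.out : p.Prime).two_le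
      ((FiniteField.pow_finrank_eq_card p V).trans hV)
  exact ⟨(Module.finBasisOfFinrankEq (ZMod p) V h).equivFun.toAddEquiv⟩

theorem traceDual_eq_orthogonal {p : ℕ} {F : Type*} [Field F] [Algebra (ZMod p) F]
    (R : AddSubgroup F) :
    traceDual p R =
      (Algebra.traceForm (ZMod p) F).orthogonal (AddSubgroup.toZModSubmodule p R) := by
  ext x
  rw [LinearMap.BilinForm.mem_orthogonal_iff]
  refine forall₂_congr fun y _ => ?_
  rw [Algebra.traceForm_apply, mul_comm]

variable {p s q m r : ℕ} [Fact p.Prime] {E F : Type*} [Field E] [Field F] [Fintype E] [Fintype F]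
  [Algebra E F] [Algebra (ZMod p) F]

omit [Fintype F] in
theorem natCard_submodule_eq [Finite F] (hE : Fintype.card E = q) (R : Submodule E F) :
    Nat.card R = q ^ Module.finrank E R := by
  rw [Module.natCard_eq_pow_finrank (K := E), Nat.card_eq_fintype_card, hE]

theorem finrank_toZModSubmodule (hq : q = p ^ s) (hE : Fintype.card E = q) (R : Submodule E F)
    (hR : Module.finrank E R = r) :
    Module.finrank (ZMod p) (AddSubgroup.toZModSubmodule p R.toAddSubgroup) = s * r := by
  refine Nat.pow_right_injective (Fact.out : p.Prime).two_le ?_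
  simp only
  rw [FiniteField.pow_finrank_eq_natCard, pow_mul, ← hq, ← hR, ← natCard_submodule_eq hE]
  rfl

/-- The dual is an orthogonal complement for the trace form, which is nondegenerate. -/
theorem finrank_traceDual (hq : q = p ^ s) (hE : Fintype.card E = q) (hF : Fintype.card F = q ^ m)
    (R : Submodule E F) (hR : Module.finrank E R = r) :
    Module.finrank (ZMod p) (traceDual p R.toAddSubgroup) = s * (m - r) := by
  have hFrank : Module.finrank (ZMod p) F = s * m := by
    refine Nat.pow_right_injective (Fact.out : p.Prime).two_le ?_
    simp only
    rw [FiniteField.pow_finrank_eq_card, hF, hq, pow_mul]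
  rw [traceDual_eq_orthogonal, LinearMap.BilinForm.finrank_orthogonal
    (traceForm_nondegenerate (ZMod p) F), hFrank, finrank_toZModSubmodule hq hE R hR, Nat.mul_sub]

theorem natCard_traceDual (hq : q = p ^ s) (hE : Fintype.card E = q) (hF : Fintype.card F = q ^ m)
    (R : Submodule E F) (hR : Module.finrank E R = r) :
    Nat.card (traceDual p R.toAddSubgroup) = q ^ (m - r) := by
  rw [← FiniteField.pow_finrank_eq_natCard p, finrank_traceDual hq hE hF R hR, pow_mul, hq]

/-- The trace dual of an `E`-subspace is an `E`-subspace. -/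
def traceDualSubmodule (p : ℕ) {E F : Type*} [Field E] [Field F] [Algebra E F]
    [Algebra (ZMod p) F] (R : Submodule E F) : Submodule E F where
  __ := (traceDual p R.toAddSubgroup).toAddSubgroup
  smul_mem' := fun c x hx y hy => by
    rw [smul_mul_assoc, ← mul_smul_comm]
    exact hx _ (R.smul_mem c hy)

theorem finrank_traceDualSubmodule (hq : q = p ^ s) (hE : Fintype.card E = q)
    (hF : Fintype.card F = q ^ m) (R : Submodule E F) (hR : Module.finrank E R = r) :
    Module.finrank E (traceDualSubmodule p R) = m - r := by
  have hq2 : 2 ≤ q := hE ▸ Fintype.one_lt_card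
  refine Nat.pow_right_injective hq2 ?_
  simp only
  rw [← natCard_submodule_eq hE, ← natCard_traceDual (p := p) hq hE hF R hR]
  rfl

end TraceDual

/-! ### Evaluation of the parameters -/

section Parameters

variable {q m l r : ℕ} {F K L : Type*} [Field F] [Field K] [Field L]
  [Fintype F] [Fintype K] [Fintype L] [Algebra F K] [Algebra F L]

theorem finrank_eq_of_card (hq : 2 ≤ q) (hm : 1 ≤ m) (hF : Fintype.card F = q ^ m)
    (hK : Fintype.card K = q ^ (m * l)) : Module.finrank F K = l := by
  have h : (q ^ m) ^ Module.finrank F K = (q ^ m) ^ l := by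
    rw [← hF, ← Module.card_eq_pow_finrank, hK, hF, pow_mul]
  exact Nat.pow_right_injective (le_trans hq (Nat.le_self_pow (by omega) q)) h

variable (hF : Fintype.card F = q ^ m)
  (hK : Fintype.card K = q ^ (m * l)) (hL : Fintype.card L = q ^ (m * (l + 1)))
  (W : AddSubgroup F) (hW : Nat.card W = q ^ (m - r))
include hF hK hL hW

theorem ncard_dualDennistonSet_eq :
    ((dualDennistonSet K L (W : Set F)).ncard : ℚ) = dualK q m l r := by
  classical
  refine Rat.cast_injective (α := ℂ) ?_
  rw [Rat.cast_natCast, ncard_dualDennistonSet]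
  have hn := normFibreCard_mul (F := F) (K := K)
  have hQ1 : (Fintype.card F : ℂ) - 1 ≠ 0 := by
    rw [sub_ne_zero]
    exact_mod_cast (Fintype.one_lt_card (α := F)).ne'
  have hn' : (normFibreCard F K : ℂ) = (Fintype.card K - 1) / (Fintype.card F - 1) := by
    rw [eq_div_iff hQ1, hn]
  rw [hn']
  rw [← Nat.card_eq_fintype_card (α := W), hW, hL]
  rw [hF] at hQ1 ⊢
  rw [hK, dualK]
  push_cast at hQ1 ⊢
  rw [show m * (l + 1) = m * l + m by ring, pow_add]
  generalize (q : ℂ) ^ (m * l) = A at *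
  generalize (q : ℂ) ^ m = Q at *
  generalize (q : ℂ) ^ (m - r) = w at *
  field_simp
  ring

variable (hq : 2 ≤ q) (hm : 1 ≤ m) (hr : r ≤ m)
include hq hm hr

theorem ncard_differences_dualDennistonSet_eq {d : K × L} (hd : d ≠ 0) :
    (d ∈ dualDennistonSet K L (W : Set F) →
      ({x : (K × L) × (K × L) | x.1 ∈ dualDennistonSet K L (W : Set F) ∧
        x.2 ∈ dualDennistonSet K L (W : Set F) ∧ x.1 ≠ x.2 ∧ x.1 - x.2 = d}.ncard : ℚ) =
        dualLam q m l r) ∧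
    (d ∉ dualDennistonSet K L (W : Set F) →
      ({x : (K × L) × (K × L) | x.1 ∈ dualDennistonSet K L (W : Set F) ∧
        x.2 ∈ dualDennistonSet K L (W : Set F) ∧ x.1 ≠ x.2 ∧ x.1 - x.2 = d}.ncard : ℚ) =
        dualMu q m l r) := by
  classical
  have hKL : Module.finrank F L = Module.finrank F K + 1 := by
    rw [finrank_eq_of_card hq hm hF hK, finrank_eq_of_card hq hm hF hL]
  have h := ncard_differences_dualDennistonSet W hKL d hd
  rw [ncard_dualDennistonSet] at h
  have hn := normFibreCard_mul (F := F) (K := K)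
  have hQ1 : (Fintype.card F : ℂ) - 1 ≠ 0 := by
    rw [sub_ne_zero]
    exact_mod_cast (Fintype.one_lt_card (α := F)).ne'
  have hn' : (normFibreCard F K : ℂ) = (Fintype.card K - 1) / (Fintype.card F - 1) := by
    rw [eq_div_iff hQ1, hn]
  have hG : (Fintype.card K : ℂ) * Fintype.card L ≠ 0 := by
    exact_mod_cast mul_ne_zero Fintype.card_ne_zero Fintype.card_ne_zero
  -- Because `r ≤ m`, the truncated subtractions can be isolated in `m - r`; the claims become
  -- rational identities in `q^(ml)`, `q^m` and `q^(m-r)`.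
  have hsub : m * (l + 1) - r = m * l + (m - r) := by
    have : m * (l + 1) = m * l + m := by ring
    omega
  have hsub' : m * (l + 2) - r = m * l + m + (m - r) := by
    have : m * (l + 2) = m * l + m + m := by ring
    omega
  have hadd : m * (l + 1) = m * l + m := by ring
  rw [hn', ← Nat.card_eq_fintype_card (α := W), hW, hL, hF, hK, hadd] at h
  rw [hF] at hQ1
  rw [hK, hL, hadd] at hG
  push_cast at h hQ1 hG
  constructor
  all_goals
    intro hmem
    refine Rat.cast_injective (α := ℂ) (mul_left_cancel₀ hG ?_)
    rw [Rat.cast_natCast]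
    rw [pow_add]
    rw [pow_add] at h
    refine h.trans ?_
  · rw [if_pos hmem, dualLam, hsub, hsub', hadd]
    push_cast
    simp only [pow_add]
    generalize (q : ℂ) ^ (m * l) = A at *
    generalize (q : ℂ) ^ m = Q at *
    generalize (q : ℂ) ^ (m - r) = w at *
    field_simp
    ring
  · rw [if_neg hmem, dualMu, hsub, hadd]
    push_cast
    simp only [pow_add]
    generalize (q : ℂ) ^ (m * l) = A at *
    generalize (q : ℂ) ^ m = Q at *
    generalize (q : ℂ) ^ (m - r) = w at *
    field_simp
    ring

theorem isPDS_dualDennistonSet {k lam mu : ℕ} (hk : (k : ℚ) = dualK q m l r)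
    (hlam : (lam : ℚ) = dualLam q m l r) (hmu : (mu : ℚ) = dualMu q m l r) :
    IsPDS (dualDennistonSet K L (W : Set F)) (q ^ (m * (2 * l + 1))) k lam mu where
  card_group := by
    rw [Nat.card_eq_fintype_card, Fintype.card_prod, hK, hL, ← pow_add]
    congr 1
    ring
  card_set := by
    have h := ncard_dualDennistonSet_eq (r := r) hF hK hL W hW
    rw [← hk] at h
    exact_mod_cast h
  finite_set := Set.toFinite _
  zero_notMem := zero_notMem_dualDennistonSet _
  card_of_mem := fun d hd => by
    have hd0 : d ≠ 0 := fun h => zero_notMem_dualDennistonSet _ (h ▸ hd)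
    have h := (ncard_differences_dualDennistonSet_eq hF hK hL W hW hq hm hr hd0).1 hd
    rw [← hlam] at h
    exact_mod_cast h
  card_of_notMem := fun d hd0 hd => by
    have h := (ncard_differences_dualDennistonSet_eq hF hK hL W hW hq hm hr hd0).2 hd
    rw [← hmu] at h
    exact_mod_cast h

/-- The parameters are natural numbers because they are actual counts: `D` is nonempty and some
nonzero element lies outside it. -/
theorem exists_parameters : ∃ k lam mu : ℕ, (k : ℚ) = dualK q m l r ∧
    (lam : ℚ) = dualLam q m l r ∧ (mu : ℚ) = dualMu q m l r := by
  obtain ⟨d, hd⟩ := dualDennistonSet_nonempty (K := K) (L := L) (W : Set F)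
  obtain ⟨d', hd0', hd'⟩ := exists_ne_zero_notMem_dualDennistonSet (K := K) (L := L) (W : Set F)
  have hd0 : d ≠ 0 := fun h => zero_notMem_dualDennistonSet _ (h ▸ hd)
  exact ⟨_, _, _, ncard_dualDennistonSet_eq hF hK hL W hW,
    (ncard_differences_dualDennistonSet_eq hF hK hL W hW hq hm hr hd0).1 hd,
    (ncard_differences_dualDennistonSet_eq hF hK hL W hW hq hm hr hd0').2 hd'⟩

end Parameters

/-! ### The maximum clique -/

section Clique

/-- No element of `D` has second coordinate zero, so the second projection is injective on every
clique and bounds its size by `|L|`. -/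
theorem isMaximumClique_zero_prod {F K L : Type*} [Field F] [Field K] [Field L]
    [Fintype K] [Fintype L] [Algebra F K] [Algebra F L] {W : Set F}
    (h0 : (0 : K × L) ∉ dualDennistonSet K L W)
    (hneg : -dualDennistonSet K L W = dualDennistonSet K L W) :
    (cayleyGraph (dualDennistonSet K L W) h0 hneg).IsMaximumClique
      (({0} : Finset K) ×ˢ (Finset.univ : Finset L)) := by
  constructor
  · rintro ⟨a, b⟩ hx ⟨a', b'⟩ hy hxy
    simp only [Finset.coe_product, Finset.coe_singleton, Finset.coe_univ, Set.mem_prod,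
      Set.mem_singleton_iff, Set.mem_univ, and_true] at hx hy
    subst hx hy
    refine mem_dualDennistonSet.2 (Or.inr ⟨sub_self _, ?_⟩)
    exact sub_ne_zero.2 fun h => hxy (Prod.ext rfl h)
  · intro t ht
    rw [Finset.card_product, Finset.card_singleton, one_mul]
    refine Finset.card_le_card_of_injOn Prod.snd (fun x _ => Finset.mem_coe.2 (Finset.mem_univ _))
      fun x hx y hy hxy => ?_
    by_contra hne
    have hadj : x - y ∈ dualDennistonSet K L W := ht hx hy hne
    have h2 : (x - y).2 = 0 := sub_eq_zero.2 hxy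
    rcases mem_dualDennistonSet.1 hadj with h | h
    · exact h.2.1 h2
    · exact h.2 h2

end Clique

/-! ### Existence of models -/

section Models

theorem exists_submodule_finrank_eq {E F : Type*} [Field E] [AddCommGroup F] [Module E F] {r : ℕ}
    (hr : r ≤ Module.finrank E F) : ∃ R : Submodule E F, Module.finrank E R = r := by
  obtain ⟨f, hf⟩ := exists_linearIndependent_of_le_finrank hr
  exact ⟨Submodule.span E (Set.range f), by rw [finrank_span_eq_card hf, Fintype.card_fin]⟩

end Models

/-- There are finite fields `F ⊆ K, L` with `q ^ m`, `q ^ (m * l)`, `q ^ (m * (l + 1))` elements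
and an additive subgroup of `F` with `q ^ (m - r)` elements. -/
theorem exists_finite_field_model {p s q m l r : ℕ} [Fact p.Prime] (hs : 1 ≤ s) (hq : q = p ^ s)
    (hm : 1 ≤ m) (hl : 1 ≤ l) (hr : r ≤ m) :
    ∃ (F K L : Type) (_ : Field F) (_ : Field K) (_ : Field L) (_ : Fintype F) (_ : Fintype K)
      (_ : Fintype L) (_ : Algebra F K) (_ : Algebra F L) (_ : CharP F p) (W : AddSubgroup F),
      Fintype.card F = q ^ m ∧ Fintype.card K = q ^ (m * l) ∧
        Fintype.card L = q ^ (m * (l + 1)) ∧ Nat.card W = q ^ (m - r) := by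
  have hm0 : NeZero m := ⟨by omega⟩
  have hl0 : NeZero l := ⟨by omega⟩
  let E := GaloisField p s
  let F := FiniteField.Extension E p m
  have hcharF : CharP F p := charP_of_injective_algebraMap (algebraMap (ZMod p) F).injective p
  let K := FiniteField.Extension F p l
  let L := FiniteField.Extension F p (l + 1)
  let _ : Fintype E := Fintype.ofFinite E
  let _ : Fintype F := Fintype.ofFinite F
  let _ : Fintype K := Fintype.ofFinite K
  let _ : Fintype L := Fintype.ofFinite L
  have hE : Nat.card E = q := by rw [hq]; exact GaloisField.card p s (by omega)
  have hF : Nat.card F = q ^ m := by rw [FiniteField.natCard_extension, hE]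
  -- A subspace of dimension `m - r` is chosen directly in place of a dual, since only the order of
  -- `W` affects the parameters.
  obtain ⟨R, hR⟩ := exists_submodule_finrank_eq (E := E) (F := F) (r := m - r)
    (by rw [FiniteField.finrank_extension]; omega)
  refine ⟨F, K, L, inferInstance, inferInstance, inferInstance, inferInstance, inferInstance,
    inferInstance, inferInstance, inferInstance, hcharF, R.toAddSubgroup, ?_, ?_, ?_, ?_⟩
  · rw [Fintype.card_eq_nat_card, hF]
  · rw [Fintype.card_eq_nat_card, FiniteField.natCard_extension, hF, pow_mul]
  · rw [Fintype.card_eq_nat_card, FiniteField.natCard_extension, hF, pow_mul]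
  · rw [← hR]
    exact natCard_submodule_eq (by rw [Fintype.card_eq_nat_card, hE]) R

theorem nonempty_prod_addEquiv {p s q m l : ℕ} [Fact p.Prime] {F K L : Type*} [Field F] [Field K]
    [Field L] [Fintype K] [Fintype L] [Algebra F K] [Algebra F L] [CharP F p] (hq : q = p ^ s)
    (hK : Fintype.card K = q ^ (m * l)) (hL : Fintype.card L = q ^ (m * (l + 1))) :
    Nonempty ((K × L) ≃+ (Fin (s * m * (2 * l + 1)) → ZMod p)) := by
  have hpK : (p : K) = 0 := by
    rw [← map_natCast (algebraMap F K), CharP.cast_eq_zero, map_zero]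
  have hpL : (p : L) = 0 := by
    rw [← map_natCast (algebraMap F L), CharP.cast_eq_zero, map_zero]
  let _ : Module (ZMod p) (K × L) :=
    AddCommGroup.zmodModule fun x => by ext <;> simp [hpK, hpL]
  refine nonempty_addEquiv_of_card ?_
  rw [Fintype.card_prod, hK, hL, ← pow_add, hq, ← pow_mul]
  congr 1
  ring

theorem dualDennistonSet_eq_compl {F K L : Type*} [Field F] [Field K] [Field L] [Algebra F K]
    [Algebra F L] {W : Set F} {U : Set (K × L)}
    (hU : ∀ x : K × L, x ∈ U ↔ x.1 ≠ 0 ∧ x.2 ≠ 0 ∧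
      Algebra.norm F x.2 / Algebra.norm F x.1 ∈ W) :
    dualDennistonSet K L W = pdsComplement (U ∪ ({0}ᶜ ×ˢ {0})) := by
  ext ⟨a, b⟩
  simp only [mem_dualDennistonSet, pdsComplement, Set.mem_compl_iff, Set.mem_union, hU,
    Set.mem_prod, Set.mem_singleton_iff, Prod.mk_eq_zero]
  tauto


end DualDenniston

/-! ### Assembly of the theorem -/

open DualDenniston in
theorem mainTheorem2 (p s q m l r : ℕ) [Fact p.Prime] (hs : 1 ≤ s) (hq : q = p ^ s)
    (hm : 1 ≤ m) (hl : 1 ≤ l) (hr : r ≤ m) :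
    -- the dual generalized Denniston parameters are natural numbers `k`, `lam`, `mu`
    ∃ k lam mu : ℕ, (k : ℚ) = DualDenniston.dualK q m l r ∧
      (lam : ℚ) = DualDenniston.dualLam q m l r ∧
      (mu : ℚ) = DualDenniston.dualMu q m l r ∧
      -- the explicit construction, where `E`, `F`, `K`, `L` are the fields with
      -- `q`, `q ^ m`, `q ^ (m * l)`, `q ^ (m * (l + 1))` elements
      (∀ (E F K L : Type*) [Field E] [Field F] [Field K] [Field L]
        [Fintype E] [Fintype F] [Fintype K] [Fintype L]
        [Algebra E F] [Algebra F K] [Algebra F L] [Algebra (ZMod p) F]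
        (_ : Fintype.card E = q) (_ : Fintype.card F = q ^ m)
        (_ : Fintype.card K = q ^ (m * l)) (_ : Fintype.card L = q ^ (m * (l + 1)))
        (R : Submodule E F) (_ : Module.finrank E R = r),
        let Rperp : Submodule (ZMod p) F := DualDenniston.traceDual p R.toAddSubgroup
        let D : Set (K × L) := DualDenniston.dualDennistonSet K L (Rperp : Set F)
        let e : ℕ := (q ^ m - 1) / (q - 1)
        -- dimensions of `R` and of its dual
        Module.finrank (ZMod p) (AddSubgroup.toZModSubmodule p R.toAddSubgroup) = s * r ∧
        Module.finrank (ZMod p) Rperp = s * (m - r) ∧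
        (∃ R' : Submodule E F, (R' : Set F) = Rperp ∧ Module.finrank E R' = m - r) ∧
        -- the group is elementary abelian
        Nonempty ((K × L) ≃+ (Fin (s * m * (2 * l + 1)) → ZMod p)) ∧
        -- `D` is a partial difference set
        DualDenniston.IsPDS D (q ^ (m * (2 * l + 1))) k lam mu ∧
        -- the Cayley graph is strongly regular, with maximum clique `{0} × L`
        (∃ (h0 : (0 : K × L) ∉ D) (hneg : -D = D),
          DualDenniston.IsSRG (DualDenniston.cayleyGraph D h0 hneg)
            (q ^ (m * (2 * l + 1))) k lam mu ∧
          (DualDenniston.cayleyGraph D h0 hneg).IsMaximumClique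
            (({0} : Finset K) ×ˢ (Finset.univ : Finset L)) ∧
          (({0} : Finset K) ×ˢ (Finset.univ : Finset L)).card = q ^ (m * (l + 1))) ∧
        -- description of `D` by cyclotomic classes, and as a complement
        (∀ γ : Fˣ, DualDenniston.IsPrimitiveElement γ →
          let Tperp : Set ℕ := DualDenniston.exponentSet γ e (Rperp : Set F)
          let TperpC : Set ℕ := Set.Iio e \ Tperp
          D = {x | x.1 ≠ 0 ∧ x.2 ≠ 0 ∧ Algebra.norm F x.2 / Algebra.norm F x.1 ∈
                ⋃ t ∈ TperpC, DualDenniston.cyclotomicClass γ e t} ∪ ({0} ×ˢ {0}ᶜ) ∧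
          (∃ (α : Kˣ) (β : Lˣ), DualDenniston.IsPrimitiveElement α ∧
            DualDenniston.IsPrimitiveElement β ∧
            Algebra.norm F (α : K) = γ ∧ Algebra.norm F (β : L) = γ) ∧
          ∀ (α : Kˣ) (β : Lˣ), DualDenniston.IsPrimitiveElement α →
            DualDenniston.IsPrimitiveElement β →
            Algebra.norm F (α : K) = γ → Algebra.norm F (β : L) = γ →
            D = DualDenniston.cyclotomicUnion α β e TperpC ∪ ({0} ×ˢ {0}ᶜ) ∧
            D = DualDenniston.pdsComplement (DualDenniston.dennistonSet α β e Tperp))) ∧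
      -- existence in the elementary abelian group of order `q ^ (m * (2 * l + 1))`
      (∃ (D : Set (Fin (s * m * (2 * l + 1)) → ZMod p)) (h0 : 0 ∉ D) (hneg : -D = D),
        DualDenniston.IsPDS D (q ^ (m * (2 * l + 1))) k lam mu ∧
        DualDenniston.IsSRG (DualDenniston.cayleyGraph D h0 hneg)
          (q ^ (m * (2 * l + 1))) k lam mu) := by
  have hq2 : 2 ≤ q := by
    rw [hq]
    exact le_trans (Fact.out : p.Prime).two_le (Nat.le_self_pow (by omega) p)
  -- The numbers `k`, `lam`, `mu` must be fixed before the fields are quantified, so they are read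
  -- off from one model, which later also supplies the set in the elementary abelian group.
  obtain ⟨F₀, K₀, L₀, _, _, _, _, _, _, _, _, _, W₀, hF₀, hK₀, hL₀, hW₀⟩ :=
    exists_finite_field_model (p := p) hs hq hm hl hr
  obtain ⟨k, lam, mu, hk, hlam, hmu⟩ := exists_parameters hF₀ hK₀ hL₀ W₀ hW₀ hq2 hm hr
  refine ⟨k, lam, mu, hk, hlam, hmu, ?_, ?_⟩
  · intro E F K L _ _ _ _ _ _ _ _ _ _ _ _ hE hF hK hL R hR Rperp D e
    have hchar : CharP F p := charP_of_injective_algebraMap (algebraMap (ZMod p) F).injective p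
    have hW : Nat.card Rperp.toAddSubgroup = q ^ (m - r) := natCard_traceDual hq hE hF R hR
    have hPDS : IsPDS D (q ^ (m * (2 * l + 1))) k lam mu :=
      isPDS_dualDennistonSet hF hK hL Rperp.toAddSubgroup hW hq2 hm hr hk hlam hmu
    have h0 : (0 : K × L) ∉ D := hPDS.zero_notMem
    have hneg : -D = D := neg_dualDennistonSet Rperp.toAddSubgroup
    refine ⟨finrank_toZModSubmodule hq hE R hR, finrank_traceDual hq hE hF R hR,
      ⟨traceDualSubmodule p R, rfl, finrank_traceDualSubmodule hq hE hF R hR⟩,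
      nonempty_prod_addEquiv (F := F) hq hK hL, hPDS, ⟨h0, hneg, ?_, ?_, ?_⟩, ?_⟩
    · exact hPDS.isSRG h0 hneg (dualDennistonSet_nonempty _)
        (exists_ne_zero_notMem_dualDennistonSet _)
    · exact isMaximumClique_zero_prod h0 hneg
    · rw [Finset.card_product, Finset.card_singleton, one_mul, Finset.card_univ, hL]
    intro γ hγ Tperp TperpC
    have hemul : e * (q - 1) = q ^ m - 1 := Nat.div_mul_cancel (Nat.sub_one_dvd_pow_sub_one q m)
    have hqm : 2 ≤ q ^ m := le_trans hq2 (Nat.le_self_pow (by omega) q)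
    have he : 0 < e := by
      rcases Nat.eq_zero_or_pos e with h | h
      · rw [h] at hemul
        omega
      · exact h
    have hord : orderOf γ = e * (q - 1) := by
      classical
      rw [orderOf_eq_card_of_zpowers_eq_top hγ, Nat.card_eq_fintype_card, Fintype.card_units, hF,
        hemul]
    have hstable : ∀ u ∈ Subgroup.zpowers (γ ^ e), ∀ w ∈ (Rperp : Set F),
        ((u : Fˣ) : F) * w ∈ (Rperp : Set F) :=
      zpowers_smul_mem (traceDualSubmodule p R) (by rw [hE, ← hord, pow_orderOf_eq_one])
    have hratio : ∀ x : K × L, x.1 ≠ 0 → x.2 ≠ 0 →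
        Algebra.norm F x.2 / Algebra.norm F x.1 ≠ 0 := fun x h1 h2 =>
      div_ne_zero (Algebra.norm_ne_zero_iff.2 h2) (Algebra.norm_ne_zero_iff.2 h1)
    have hDcyc : D = {x | x.1 ≠ 0 ∧ x.2 ≠ 0 ∧ Algebra.norm F x.2 / Algebra.norm F x.1 ∈
        ⋃ t ∈ TperpC, cyclotomicClass γ e t} ∪ ({0} ×ˢ {0}ᶜ) := by
      refine congrArg (· ∪ _) (Set.ext fun x => and_congr_right fun h1 => and_congr_right fun h2 =>
        ?_)
      rw [mem_iUnion_cyclotomicClass_diff_exponentSet hγ he hstable]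
      exact (and_iff_right (hratio x h1 h2)).symm
    refine ⟨hDcyc, ?_, ?_⟩
    · obtain ⟨α, hα, hNα⟩ := exists_isPrimitiveElement_norm_eq (K := K) hγ
      obtain ⟨β, hβ, hNβ⟩ := exists_isPrimitiveElement_norm_eq (K := L) hγ
      exact ⟨α, β, hα, hβ, hNα, hNβ⟩
    · intro α β hα hβ hNα hNβ
      have hmem : ∀ (T : Set ℕ) (x : K × L), x ∈ cyclotomicUnion α β e T ↔ x.1 ≠ 0 ∧ x.2 ≠ 0 ∧
          Algebra.norm F x.2 / Algebra.norm F x.1 ∈ ⋃ t ∈ T, cyclotomicClass γ e t := fun T x =>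
        mem_cyclotomicUnion_iff hα hβ hNα hNβ he ⟨_, hord⟩
      refine ⟨?_, ?_⟩
      · rw [hDcyc]
        exact congrArg (· ∪ _) (Set.ext fun x => (hmem _ x).symm)
      · refine dualDennistonSet_eq_compl fun x => (hmem _ x).trans ?_
        refine and_congr_right fun h1 => and_congr_right fun h2 => ?_
        rw [mem_iUnion_cyclotomicClass_exponentSet hγ he hstable]
        exact and_iff_right (hratio x h1 h2)
  · obtain ⟨φ⟩ := nonempty_prod_addEquiv (p := p) (F := F₀) hq hK₀ hL₀
    have hPDS₀ : IsPDS (dualDennistonSet K₀ L₀ (W₀ : Set F₀)) (q ^ (m * (2 * l + 1))) k lam mu :=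
      isPDS_dualDennistonSet hF₀ hK₀ hL₀ W₀ hW₀ hq2 hm hr hk hlam hmu
    have hPDS := hPDS₀.map φ
    have hneg : -(φ '' dualDennistonSet K₀ L₀ (W₀ : Set F₀)) =
        φ '' dualDennistonSet K₀ L₀ (W₀ : Set F₀) := by
      conv_rhs => rw [← neg_dualDennistonSet W₀]
      exact (Set.image_neg φ _).symm
    refine ⟨_, hPDS.zero_notMem, hneg, hPDS, ?_⟩
    refine hPDS.isSRG _ _ ((dualDennistonSet_nonempty _).image φ) ?_
    obtain ⟨x, hx0, hx⟩ := exists_ne_zero_notMem_dualDennistonSet (K := K₀) (L := L₀) (W₀ : Set F₀)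
    exact ⟨φ x, by simpa using hx0, fun h => hx ((φ.injective.mem_set_image).1 h)⟩
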